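/- Let $L$ be a finite lattice with minimum $\hat 0$ and maximum $\hat 1$. It is a geometric lattice of rank $n$ if it has a rank function $\mathrm{rk}:L\to\mathbb{N}$ with $\mathrm{rk}(\hat 0)=0$, $\mathrm{rk}(y)=\mathrm{rk}(x)+1$ whenever $y$ covers $x$, and $\mathrm{rk}(\hat 1)=n$, such that $\mathrm{rk}(x)+\mathrm{rk}(y)\ge \mathrm{rk}(x\vee y)+\mathrm{rk}(x\wedge y)$ for all $x,y\in L$, and every element of $L$ is a join of atoms. Let $\overline L=L\setminus\{\hat 0,\hat 1\}$, identified with its order complex, whose simplices are the chains of $\overline L$. The lattice $L$ is homogeneous if $\mathrm{Aut}(L)$ is transitive on the $(n-2)$-dimensional simplices of $\overline L$. For a finite simplicial complex $X$, let $X(k)$ be its set of $k$-dimensional simplices, with $X(-1)=\{\emptyset\}$ and $X(k)=\emptyset$ for $k<-1$ (the reduced setting), and let $f_k(X)=|X(k)|$. Let $C^k(X)$ be the space of functions $X(k)\to\mathbb{Z}/2$, let $d_k:C^k(X)\to C^{k+1}(X)$ be the (reduced) coboundary operator, and let $B^k(X)=d_{k-1}(C^{k-1}(X))$. For $\phi\in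 C^k(X)$ let $\|\phi\|=|\{\sigma\in X(k):\phi(\sigma)\ne 0\}|$ and $\|\phi\|_{csy}=\min_{\psi\in C^{k-1}(X)}\|\phi+d_{k-1}\psi\|$. The $k$-th Cheeger constant of $X$ is $$h^k(X)=\min_{\phi\in C^k(X)\setminus B^k(X)}\frac{\|d_k\phi\|}{\|\phi\|_{csy}}.$$ (1) If $L$ is a finite homogeneous geometric lattice of rank $n\ge 2$, then $$h^{n-3}(\overline L)\ \ge\ \frac{f_{n-2}(\overline L)}{f_{n-3}(\overline L)\,\sum_{j=1}^{n-1}j!}.$$ (2) Let $n\ge 2$, let $\mathbb{F}_q$ be a finite field with $q$ elements, and let $A_{n-1}(\mathbb{F}_q)$ be the order complex of the poset of linear subspaces of $\mathbb{F}_q^n$ other than $0$ and $\mathbb{F}_q^n$. Then $$h^{n-3}(A_{n-1}(\mathbb{F}_q))\ \ge\ \frac{f_{n-2}(A_{n-1}(\mathbb{F}_q))}{f_{n-3}(A_{n-1}(\mathbb{F}_q))\,\sum_{j=1}^{n-1}j!}\ =\ \frac{q+1}{(n-1)\sum_{j=1}^{n-1}j!}.$$ -/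

import Mathlib

namespace CheegerLattice

/-! ### Cochains of a simplicial complex with `ZMod 2` coefficients (reduced setting) -/

section Complex

variable {V : Type*} (X : AbstractSimplicialComplex V)

/-- The `k`-dimensional simplices of `X` in the reduced setting: the empty simplex is the unique
simplex of dimension `-1`, and there are none in dimension `< -1`. -/
def Face (k : ℤ) : Type _ :=
  {s : Finset V // (s = ∅ ∨ s ∈ X.faces) ∧ (s.card : ℤ) = k + 1}

/-- The number `f_k(X)` of `k`-dimensional simplices. -/
noncomputable def faceCount (k : ℤ) : ℕ := Nat.card (Face X k)

/-- The space `C^k(X; ZMod 2)` of (reduced) `k`-cochains. -/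
abbrev Cochain (k : ℤ) : Type _ := Face X k → ZMod 2

variable {X}

open Classical in
/-- The codimension one face of the simplex `τ` obtained by deleting the vertex `v`. -/
noncomputable def Face.delete {j k : ℤ} (h : j + 1 = k) (τ : Face X k) (v : τ.1) : Face X j :=
  ⟨τ.1.erase v, by
    refine ⟨?_, ?_⟩
    · rcases (τ.1.erase v.1).eq_empty_or_nonempty with he | hne
      · exact Or.inl he
      · rcases τ.2.1 with h0 | hf
        · exact absurd v.2 (by simp [h0])
        · exact Or.inr ((X.isRelLowerSet_faces hf).2 (Finset.erase_subset _ _) hne)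
    · have h1 := Finset.card_erase_add_one v.2
      have h2 := τ.2.2
      omega⟩

/-- The coboundary operator `d_j : C^j(X) → C^(j+1)(X)`; the target degree is a parameter `k`
with `j + 1 = k`. -/
noncomputable def coboundary {j k : ℤ} (h : j + 1 = k) (φ : Cochain X j) : Cochain X k :=
  fun τ => ∑ v : τ.1, φ (τ.delete h v)

/-- The norm of a cochain: the size of its support. -/
noncomputable def cochainNorm {k : ℤ} (φ : Cochain X k) : ℕ := Nat.card {σ : Face X k // φ σ ≠ 0}

/-- The cosystolic norm: the minimum of `‖φ + d_(k-1) ψ‖` over `ψ ∈ C^(k-1)(X)`. -/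
noncomputable def cosystolicNorm {k : ℤ} (φ : Cochain X k) : ℕ :=
  ⨅ ψ : Cochain X (k - 1), cochainNorm (φ + coboundary (sub_add_cancel k 1) ψ)

variable (X) in
/-- The set `B^k(X)` of `k`-coboundaries. -/
def coboundaries (k : ℤ) : Set (Cochain X k) :=
  Set.range (coboundary (X := X) (sub_add_cancel k 1))

/-- The coboundary expansion `‖d_k φ‖ / ‖φ‖_csy` (used for `φ ∉ B^k(X)`, where the denominator
is nonzero if `X` is finite). -/
noncomputable def expansion {k : ℤ} (φ : Cochain X k) : ℝ :=
  (cochainNorm (coboundary (rfl : k + 1 = k + 1) φ) : ℝ) / (cosystolicNorm φ : ℝ)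

variable (X) in
/-- The `k`-th Cheeger constant `h^k(X)` of a finite complex: the minimum of the coboundary
expansion over `C^k(X) \ B^k(X)`. -/
noncomputable def cheeger (k : ℤ) : ℝ := sInf (expansion '' (coboundaries X k)ᶜ)

end Complex

/-! ### Order complexes and geometric lattices -/

/-- The order complex of a poset: simplices are the nonempty finite chains. -/
def orderComplex (P : Type*) [PartialOrder P] : AbstractSimplicialComplex P where
  faces := {s | s.Nonempty ∧ IsChain (· ≤ ·) (s : Set P)}
  isRelLowerSet_faces := fun {_} hs =>
    ⟨hs.1, fun _ hts ht => ⟨ht, hs.2.mono (Finset.coe_subset.mpr hts)⟩⟩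
  singleton_mem := fun v => ⟨Finset.singleton_nonempty v, by simp⟩

section Lattice

variable (L : Type*) [Lattice L] [BoundedOrder L]

/-- The proper part of `L`: all elements other than the minimum and the maximum. -/
abbrev ProperPart : Type _ := {x : L // x ≠ ⊥ ∧ x ≠ ⊤}

/-- `L` is a geometric lattice with rank function `rk`. In a ranked lattice the elements of rank
one are the atoms. -/
structure IsGeometricLattice (rk : L → ℕ) : Prop where
  rk_bot : rk ⊥ = 0
  rk_covBy : ∀ x y : L, x ⋖ y → rk y = rk x + 1
  semimodular : ∀ x y : L, rk (x ⊔ y) + rk (x ⊓ y) ≤ rk x + rk y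
  join_atoms : ∀ x : L, ∃ A : Finset L, (∀ a ∈ A, IsAtom a) ∧ A.sup id = x

/-- The automorphism group of `L` (of rank `n`) is transitive on the `(n-2)`-dimensional simplices
of the order complex of the proper part. -/
def IsHomogeneous (n : ℕ) : Prop :=
  ∀ σ τ : Face (orderComplex (ProperPart L)) ((n : ℤ) - 2), ∃ g : L ≃o L,
    g '' (Subtype.val '' (σ.1 : Set (ProperPart L))) = Subtype.val '' (τ.1 : Set (ProperPart L))

end Lattice

/-- The spherical building `A_(n-1)(F)`: the order complex of the poset of nonzero proper linear
subspaces of `F^n`. -/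
abbrev building (F : Type*) [Field F] (n : ℕ) :
    AbstractSimplicialComplex (ProperPart (Submodule F (Fin n → F))) :=
  orderComplex (ProperPart (Submodule F (Fin n → F)))

end CheegerLattice

/-! The engine is an explicit contracting homotopy with few terms, followed by averaging over
automorphisms.

Choose an atom `v x ≤ x` for every `x ≠ ⊥` and put `a = v ⊤`. A simplex spanned by atoms maps into
the lattice after barycentric subdivision, by sending a set of atoms to its join. A chain `x₁ < ...
< xₘ` with `m = n - 2` is connected by a prism to the subdivision of `v x₁, ..., v xₘ`, and that
subdivision bounds against the subdivision of `a, v x₁, ..., v xₘ`. The joins used lie below some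
`xᵢ` or are joins of at most `n - 1` atoms; by semimodularity the latter have rank below `n`, so
nothing leaves the proper part. The resulting sum `c(σ)` has `1! + ... + (n-1)!` terms and satisfies
`∂c(σ) = σ + c(∂σ)` modulo 2. With `ψ = φ ∘ c` this reads `φ + dψ = (dφ) ∘ c`, so every simplex in
the support of `φ + dψ` has a simplex of the support of `dφ` among the terms of its contraction
(`IsGeometricLattice.exists_filling`). The algebra is carried out on arbitrary lists, where
`listEval_listCoboundary_contraction` holds for every function; `extend` transports it to cochains,
with degenerate lists counting as zero.

The choice of `v` has no symmetry, so some top simplices may occur in many contractions. Applying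
the construction to all translates of `φ` and averaging, transitivity replaces the multiplicity of a
top simplex by its mean, which is at most `f_{n-3} N / f_{n-2}` (`faceCount_mul_cosystolicNorm_le`).

For subspaces, two complete flags have adapted bases, and the linear map matching these gives
homogeneity. Counting incidences between facets and ridges, with `n - 1` ridges in each facet and `q
+ 1` facets on each ridge, gives the closed form. -/

namespace CheegerLattice

/-! ### Chains of lists modulo two -/

section Lists

variable {α : Type*}

/-- The lists obtained from `l` by deleting one entry. -/
def listBoundary : List α → List (List α)
  | [] => []
  | x :: l => l :: (listBoundary l).map (x :: ·)

/-- The value of a function on a formal sum of lists. -/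
def listEval (F : List α → ZMod 2) (c : List (List α)) : ZMod 2 := (c.map F).sum

/-- The coboundary of a function on lists. -/
def listCoboundary (F : List α → ZMod 2) (l : List α) : ZMod 2 := listEval F (listBoundary l)

@[simp] lemma listEval_nil (F : List α → ZMod 2) : listEval F [] = 0 := rfl

@[simp] lemma listEval_cons (F : List α → ZMod 2) (l : List α) (c : List (List α)) :
    listEval F (l :: c) = F l + listEval F c := by simp [listEval]

@[simp] lemma listEval_append (F : List α → ZMod 2) (c e : List (List α)) :
    listEval F (c ++ e) = listEval F c + listEval F e := by simp [listEval]

@[simp] lemma listEval_map (F : List α → ZMod 2) (g : List α → List α) (c : List (List α)) :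
    listEval F (c.map g) = listEval (fun l => F (g l)) c := by
  simp [listEval, Function.comp_def]

@[simp] lemma listEval_flatMap (F : List α → ZMod 2) (g : List α → List (List α))
    (c : List (List α)) :
    listEval F (c.flatMap g) = listEval (fun l => listEval F (g l)) c := by
  induction c with
  | nil => rfl
  | cons l c ih => simp [ih]

lemma listEval_add (F G : List α → ZMod 2) (c : List (List α)) :
    listEval (fun l => F l + G l) c = listEval F c + listEval G c := by
  simp [listEval, List.sum_map_add]

@[simp] lemma listEval_zero (c : List (List α)) : listEval (fun _ => 0) c = 0 := by
  simp [listEval]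

lemma listEval_congr {F G : List α → ZMod 2} {c : List (List α)} (h : ∀ l ∈ c, F l = G l) :
    listEval F c = listEval G c := by
  simp only [listEval]
  rw [List.map_congr_left h]

@[simp] lemma listCoboundary_nil (F : List α → ZMod 2) : listCoboundary F [] = 0 := rfl

lemma listCoboundary_cons (F : List α → ZMod 2) (x : α) (l : List α) :
    listCoboundary F (x :: l) = F l + listCoboundary (fun m => F (x :: m)) l := by
  simp [listCoboundary, listBoundary]

lemma listCoboundary_append (F : List α → ZMod 2) (l m : List α) :
    listCoboundary F (l ++ m) =
      listCoboundary (fun u => F (u ++ m)) l + listCoboundary (fun u => F (l ++ u)) m := by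
  induction l generalizing F with
  | nil => simp
  | cons x l ih => simp [listCoboundary_cons, ih, add_assoc]

lemma listCoboundary_map {β : Type*} (F : List β → ZMod 2) (f : α → β) (l : List α) :
    listCoboundary F (l.map f) = listCoboundary (fun u => F (u.map f)) l := by
  induction l generalizing F with
  | nil => rfl
  | cons x l ih => simp [listCoboundary_cons, ih]

@[simp] lemma listCoboundary_zero (l : List α) : listCoboundary (fun _ => 0) l = 0 :=
  listEval_zero _

lemma listCoboundary_add (F G : List α → ZMod 2) (l : List α) :
    listCoboundary (fun u => F u + G u) l = listCoboundary F l + listCoboundary G l :=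
  listEval_add F G _

/-- Peeling off the head `x` produces `listCoboundary F l` twice, which cancels in characteristic
two, plus a double coboundary on the shorter list. -/
lemma listCoboundary_listCoboundary (F : List α → ZMod 2) (l : List α) :
    listCoboundary (listCoboundary F) l = 0 := by
  induction l generalizing F with
  | nil => rfl
  | cons x l ih =>
    simp only [listCoboundary_cons, listCoboundary_add]
    rw [ih]
    simp [CharTwo.add_self_eq_zero]

lemma length_listBoundary (l : List α) : (listBoundary l).length = l.length := by
  induction l with
  | nil => rfl
  | cons x l ih => simp [listBoundary, ih]

lemma length_add_one_of_mem_listBoundary {l u : List α} (h : u ∈ listBoundary l) :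
    u.length + 1 = l.length := by
  induction l generalizing u with
  | nil => simp [listBoundary] at h
  | cons x l ih =>
    simp only [listBoundary, List.mem_cons, List.mem_map] at h
    rcases h with rfl | ⟨w, hw, rfl⟩
    · rfl
    · simp [ih hw]

lemma sublist_of_mem_listBoundary {l u : List α} (h : u ∈ listBoundary l) : u.Sublist l := by
  induction l generalizing u with
  | nil => simp [listBoundary] at h
  | cons x l ih =>
    simp only [listBoundary, List.mem_cons, List.mem_map] at h
    rcases h with rfl | ⟨w, hw, rfl⟩
    · exact List.sublist_cons_self _ _
    · exact (ih hw).cons_cons x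

end Lists

/-! ### Barycentric subdivision and the contraction -/

section Contraction

variable {L : Type*} [SemilatticeSup L] [OrderBot L]

/-- The join of the entries of a list. -/
def listSup (w : List L) : L := w.foldr (· ⊔ ·) ⊥

@[simp] lemma listSup_nil : listSup ([] : List L) = ⊥ := rfl

@[simp] lemma listSup_cons (x : L) (w : List L) : listSup (x :: w) = x ⊔ listSup w := rfl

lemma le_listSup {w : List L} {x : L} (h : x ∈ w) : x ≤ listSup w := by
  induction w with
  | nil => simp at h
  | cons y w ih =>
    rcases List.mem_cons.1 h with rfl | h
    · exact le_sup_left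
    · exact (ih h).trans le_sup_right

lemma listSup_le {w : List L} {b : L} (h : ∀ x ∈ w, x ≤ b) : listSup w ≤ b := by
  induction w with
  | nil => simp
  | cons y w ih =>
    exact sup_le (h y (by simp)) (ih fun x hx => h x (by simp [hx]))

lemma listSup_mono {u w : List L} (h : u ⊆ w) : listSup u ≤ listSup w :=
  listSup_le fun _ hx => le_listSup (h hx)

/-- The barycentric subdivision of the simplex spanned by a list `w` of length `k`: the formal sum
of the chains of joins of the initial segments of the permutations of `w`. -/
def subdivision : ℕ → List L → List (List L)
  | 0, _ => [[]]
  | k + 1, w => ((listBoundary w).flatMap (subdivision k)).map (· ++ [listSup w])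

lemma length_subdivision {k : ℕ} {w : List L} (h : w.length = k) :
    (subdivision k w).length = k.factorial := by
  induction k generalizing w with
  | zero => rfl
  | succ k ih =>
    have h1 : ∀ u ∈ listBoundary w, (subdivision k u).length = k.factorial := fun u hu =>
      ih (by have := length_add_one_of_mem_listBoundary hu; omega)
    simp only [subdivision, List.length_map, List.length_flatMap]
    rw [List.map_congr_left h1]
    simp [length_listBoundary, h, Nat.factorial_succ]

lemma length_of_mem_subdivision {k : ℕ} {w u : List L} (h : u ∈ subdivision k w) :
    u.length = k := by
  induction k generalizing w u with
  | zero => simp_all [subdivision]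
  | succ k ih =>
    simp only [subdivision, List.mem_map, List.mem_flatMap] at h
    obtain ⟨u', ⟨w', -, hu'⟩, rfl⟩ := h
    simp [ih hu']

lemma le_listSup_of_mem_subdivision {k : ℕ} {w u : List L} (h : u ∈ subdivision k w) {x : L}
    (hx : x ∈ u) : x ≤ listSup w := by
  induction k generalizing w u with
  | zero => simp_all [subdivision]
  | succ k ih =>
    simp only [subdivision, List.mem_map, List.mem_flatMap] at h
    obtain ⟨u', ⟨w', hw', hu'⟩, rfl⟩ := h
    rcases List.mem_append.1 hx with hx | hx
    · exact (ih hu' hx).trans (listSup_mono (sublist_of_mem_listBoundary hw').subset)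
    · exact (List.mem_singleton.1 hx).le

lemma ne_bot_of_mem_subdivision {k : ℕ} {w u : List L} (hk : w.length = k)
    (hw : ∀ x ∈ w, x ≠ ⊥) (h : u ∈ subdivision k w) {x : L} (hx : x ∈ u) : x ≠ ⊥ := by
  induction k generalizing w u with
  | zero => simp_all [subdivision]
  | succ k ih =>
    simp only [subdivision, List.mem_map, List.mem_flatMap] at h
    obtain ⟨u', ⟨w', hw', hu'⟩, rfl⟩ := h
    rcases List.mem_append.1 hx with hx | hx
    · have := length_add_one_of_mem_listBoundary hw'
      exact ih (by omega) (fun y hy => hw y ((sublist_of_mem_listBoundary hw').subset hy)) hu' hx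
    · obtain ⟨y, hy⟩ := List.exists_mem_of_length_pos (l := w) (by omega)
      rw [List.mem_singleton.1 hx]
      exact fun h0 => hw y hy (le_bot_iff.1 (h0 ▸ le_listSup hy))

lemma pairwise_of_mem_subdivision {k : ℕ} {w u : List L} (h : u ∈ subdivision k w) :
    u.Pairwise (· ≤ ·) := by
  induction k generalizing w u with
  | zero => simp_all [subdivision]
  | succ k ih =>
    have hle := fun {x : L} => le_listSup_of_mem_subdivision h (x := x)
    simp only [subdivision, List.mem_map, List.mem_flatMap] at h
    obtain ⟨u', ⟨w', hw', hu'⟩, rfl⟩ := h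
    rw [List.pairwise_append]
    refine ⟨ih hu', by simp, fun x hx y hy => ?_⟩
    rw [List.mem_singleton.1 hy]
    exact hle (by simp [hx])

/-- Subdivision is a chain map, in dual form: faces omitting the final join `listSup w` give the
subdivided boundary, and all other faces cancel in pairs. -/
lemma listEval_listCoboundary_subdivision (F : List L → ZMod 2) {k : ℕ} {w : List L}
    (h : w.length = k + 1) :
    listEval (listCoboundary F) (subdivision (k + 1) w) =
      listCoboundary (fun u => listEval F (subdivision k u)) w := by
  induction k generalizing w F with
  | zero =>
    obtain ⟨x, rfl⟩ := List.length_eq_one_iff.1 h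
    simp [subdivision, listBoundary, listCoboundary]
  | succ k ih =>
    rw [subdivision]
    simp only [listEval_map, listEval_flatMap, listCoboundary_append]
    simp only [listCoboundary_cons, listCoboundary_nil, List.append_nil, add_zero, listEval_add]
    rw [listCoboundary]
    -- By the induction hypothesis on each face of `w`, this term is a double coboundary evaluated
    -- at `w`.
    rw [show listEval (fun l => listEval (fun l => listCoboundary (fun u => F (u ++ [listSup w])) l)
      (subdivision (k + 1) l)) (listBoundary w) = 0 from ?_, zero_add]
    refine (listEval_congr fun u hu => ih (fun u => F (u ++ [listSup w])) ?_).trans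
      (listCoboundary_listCoboundary _ w)
    have := length_add_one_of_mem_listBoundary hu
    omega

lemma listEval_listCoboundary_subdivision_length (F : List L → ZMod 2) (w : List L) :
    listEval (listCoboundary F) (subdivision w.length w) =
      listCoboundary (fun u => listEval F (subdivision u.length u)) w := by
  cases h : w.length with
  | zero => simp [List.length_eq_zero_iff.1 h, subdivision]
  | succ k =>
    rw [listEval_listCoboundary_subdivision F h]
    refine listEval_congr fun u hu => ?_
    rw [show u.length = k by have := length_add_one_of_mem_listBoundary hu; omega]

/-! ### The prism and the contraction -/

variable (v : L → L)

/-- The prism operator joining a chain to the subdivision of its image under `v`. -/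
def prism : List L → List L → List (List L)
  | _, [] => []
  | p, x :: l =>
    (subdivision (p.length + 1) (p ++ [v x])).map (· ++ x :: l) ++ prism (p ++ [v x]) l

lemma listEval_prism_cons (F : List L → ZMod 2) (p : List L) (x : L) (l : List L) :
    listEval F (prism v p (x :: l)) =
      listEval (fun u => F (u ++ x :: l)) (subdivision (p ++ [v x]).length (p ++ [v x])) +
        listEval F (prism v (p ++ [v x]) l) := by
  simp [prism]

/-- Homotopy formula for prisms, generalized over the prefix `p` of images already processed so that
induction on `l` works. The first two terms are the two ends of the prism, the last two its sides;
with `p = []` the ends are `l` itself and the subdivision of `l.map v`. -/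
lemma listEval_listCoboundary_prism (F : List L → ZMod 2) (p l : List L) :
    listEval (listCoboundary F) (prism v p l) =
      listEval (fun u => F (u ++ l)) (subdivision p.length p) +
      listEval F (subdivision (p ++ l.map v).length (p ++ l.map v)) +
      listCoboundary (fun q => listEval F (prism v q l)) p +
      listCoboundary (fun m => listEval F (prism v p m)) l := by
  induction l generalizing p with
  | nil => simp [prism, CharTwo.add_self_eq_zero]
  | cons x l ih =>
    rw [listEval_prism_cons, ih]
    simp only [listCoboundary_append _ _ (x :: l), listEval_add]
    rw [listEval_listCoboundary_subdivision_length]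
    simp only [listCoboundary_append _ p [v x], listCoboundary_cons, listCoboundary_nil,
      List.append_nil, add_zero, listEval_prism_cons, listCoboundary_add, listEval_add,
      List.map_cons, List.append_assoc, List.cons_append, List.nil_append]
    have hc : listEval (fun u => listCoboundary (fun m => F (u ++ x :: m)) l)
        (subdivision (p ++ [v x]).length (p ++ [v x])) =
        listCoboundary (fun m => listEval (fun u => F (u ++ x :: m))
          (subdivision (p ++ [v x]).length (p ++ [v x]))) l := by
      generalize subdivision (p ++ [v x]).length (p ++ [v x]) = c
      induction c with
      | nil => simp [listCoboundary]
      | cons u c ih => simp [ih, listCoboundary_add]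
    rw [hc]
    -- `A` arises twice: from deleting `x` in the current block, and as the initial end of the prism
    -- with prefix `p ++ [v x]`.
    generalize listEval (fun u => F (u ++ l)) (subdivision (p ++ [v x]).length (p ++ [v x])) = A
    linear_combination A * (CharTwo.two_eq_zero (R := ZMod 2))

/-- The contraction of a chain `l` towards the atom `a`. -/
def contraction (a : L) (l : List L) : List (List L) :=
  prism v [] l ++ subdivision (l.length + 1) (a :: l.map v)

/-- Dual form of `∂c(l) = l + c(∂l)`. The subdivision of `l.map v` is both the far end of the prism
and the face of the last simplex omitting `a`, so it cancels. -/
lemma listEval_listCoboundary_contraction (F : List L → ZMod 2) (a : L) (l : List L) :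
    listEval (listCoboundary F) (contraction v a l) =
      F l + listCoboundary (fun m => listEval F (contraction v a m)) l := by
  have h := listEval_listCoboundary_subdivision_length F (a :: l.map v)
  simp only [List.length_cons, List.length_map] at h
  simp only [contraction, listEval_append, listCoboundary_add, listEval_listCoboundary_prism, h]
  simp only [listCoboundary_cons, listCoboundary_map, listCoboundary_nil, List.nil_append,
    List.length_map, List.length_nil, subdivision, listEval_cons, listEval_nil, List.length_cons]
  generalize listEval F (subdivision l.length (l.map v)) = A
  linear_combination A * (CharTwo.two_eq_zero (R := ZMod 2))

/-- The block whose prefix has grown to length `j` contributes a subdivided simplex on `j` vertices,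
hence `j!` terms. -/
lemma length_prism (p l : List L) :
    (prism v p l).length =
      ∑ j ∈ Finset.Icc (p.length + 1) (p.length + l.length), j.factorial := by
  induction l generalizing p with
  | nil => simp [prism]
  | cons x l ih =>
    have h := length_subdivision (w := p ++ [v x]) (k := p.length + 1) (by simp)
    simp only [prism, List.length_append, List.length_map, h, ih, List.length_cons,
      List.length_nil, zero_add]
    rw [Finset.Icc_eq_cons_Ioc (show p.length + 1 ≤ p.length + (l.length + 1) by omega), Finset.sum_cons, ← Finset.Icc_add_one_left_eq_Ioc,
      show p.length + 1 + l.length = p.length + (l.length + 1) by omega]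

lemma length_contraction (a : L) (l : List L) :
    (contraction v a l).length = ∑ j ∈ Finset.Icc 1 (l.length + 1), j.factorial := by
  have h := length_subdivision (w := a :: l.map v) (k := l.length + 1) (by simp)
  rw [contraction, List.length_append, length_prism, h, Finset.sum_Icc_succ_top (by omega)]
  simp

/-- Every image in the prefix lies below the entry where the block switches to `l`, so the joins lie
below that entry as well and the concatenation is increasing. -/
lemma mem_prism {p l u : List L} (hp : ∀ q ∈ p, q ≠ ⊥) (hpl : ∀ q ∈ p, ∀ x ∈ l, q ≤ x)
    (hl : l.Pairwise (· ≤ ·)) (hl0 : ∀ x ∈ l, x ≠ ⊥) (hv : ∀ x ∈ l, v x ≤ x)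
    (hv0 : ∀ x ∈ l, v x ≠ ⊥) (hu : u ∈ prism v p l) :
    u.length = p.length + l.length + 1 ∧ u.Pairwise (· ≤ ·) ∧
      ∀ y ∈ u, y ≠ ⊥ ∧ ∃ x ∈ l, y ≤ x := by
  induction l generalizing p with
  | nil => simp [prism] at hu
  | cons x l ih =>
    obtain ⟨hxl, hl⟩ := List.pairwise_cons.1 hl
    have hp' : ∀ q ∈ p ++ [v x], q ≠ ⊥ := by
      intro q hq
      rcases List.mem_append.1 hq with hq | hq
      · exact hp q hq
      · exact List.mem_singleton.1 hq ▸ hv0 x (by simp)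
    have hpx : ∀ q ∈ p ++ [v x], q ≤ x := by
      intro q hq
      rcases List.mem_append.1 hq with hq | hq
      · exact hpl q hq x (by simp)
      · exact List.mem_singleton.1 hq ▸ hv x (by simp)
    rw [prism, List.mem_append, List.mem_map] at hu
    rcases hu with ⟨u, hu, rfl⟩ | hu
    · have hux : ∀ y ∈ u, y ≤ x := fun y hy =>
        (le_listSup_of_mem_subdivision hu hy).trans (listSup_le hpx)
      refine ⟨by simp [length_of_mem_subdivision hu]; omega, ?_, fun y hy => ?_⟩
      · refine List.pairwise_append.2 ⟨pairwise_of_mem_subdivision hu,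
          List.pairwise_cons.2 ⟨hxl, hl⟩, fun y hy z hz => (hux y hy).trans ?_⟩
        rcases List.mem_cons.1 hz with rfl | hz
        · exact le_rfl
        · exact hxl z hz
      · rcases List.mem_append.1 hy with hy | hy
        · exact ⟨ne_bot_of_mem_subdivision (by simp) hp' hu hy, x, by simp, hux y hy⟩
        · exact ⟨hl0 y hy, y, hy, le_rfl⟩
    · obtain ⟨h1, h2, h3⟩ := ih hp' (fun q hq y hy => (hpx q hq).trans (hxl y hy)) hl
        (fun y hy => hl0 y (by simp [hy])) (fun y hy => hv y (by simp [hy]))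
        (fun y hy => hv0 y (by simp [hy])) hu
      refine ⟨by simp [h1]; omega, h2, fun y hy => ?_⟩
      obtain ⟨h4, z, hz, hyz⟩ := h3 y hy
      exact ⟨h4, z, by simp [hz], hyz⟩

lemma mem_contraction {a : L} {l u : List L} (ha : a ≠ ⊥)
    (hl : l.Pairwise (· ≤ ·)) (hl0 : ∀ x ∈ l, x ≠ ⊥) (hv : ∀ x ∈ l, v x ≤ x)
    (hv0 : ∀ x ∈ l, v x ≠ ⊥) (hu : u ∈ contraction v a l) :
    u.length = l.length + 1 ∧ u.Pairwise (· ≤ ·) ∧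
      ∀ y ∈ u, y ≠ ⊥ ∧ ((∃ x ∈ l, y ≤ x) ∨ y ≤ listSup (a :: l.map v)) := by
  rcases List.mem_append.1 hu with hu | hu
  · obtain ⟨h1, h2, h3⟩ := mem_prism v (by simp) (by simp) hl hl0 hv hv0 hu
    exact ⟨by simpa using h1, h2, fun y hy => ⟨(h3 y hy).1, Or.inl (h3 y hy).2⟩⟩
  · refine ⟨length_of_mem_subdivision hu, pairwise_of_mem_subdivision hu, fun y hy =>
      ⟨ne_bot_of_mem_subdivision (by simp) ?_ hu hy,
        Or.inr (le_listSup_of_mem_subdivision hu hy)⟩⟩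
    simpa [ha] using hv0

end Contraction

/-! ### Cochains as functions on lists -/

section Extend

variable {V L : Type*} {X : AbstractSimplicialComplex V}

instance [Finite V] (k : ℤ) : Finite (Face X k) := by
  classical
  have := Fintype.ofFinite V
  unfold Face
  infer_instance

lemma Face.ext {k : ℤ} {σ τ : Face X k} (h : ∀ p, p ∈ σ.1 ↔ p ∈ τ.1) : σ = τ :=
  Subtype.ext (Finset.ext h)

/-- The list `l` enumerates without repetition the images under `f` of the vertices of `τ`. -/
def IsListing (f : V → L) (l : List L) {k : ℤ} (τ : Face X k) : Prop :=
  l.Nodup ∧ ∀ y, y ∈ l ↔ ∃ p ∈ τ.1, f p = y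

variable {f : V → L}

lemma IsListing.unique (hf : f.Injective) {l : List L} {k : ℤ} {σ τ : Face X k}
    (hσ : IsListing f l σ) (hτ : IsListing f l τ) : σ = τ := by
  have key : ∀ {σ τ : Face X k}, IsListing f l σ → IsListing f l τ → ∀ p ∈ σ.1, p ∈ τ.1 := by
    intro σ τ hσ hτ p hp
    obtain ⟨q, hq, h⟩ := (hτ.2 _).1 ((hσ.2 (f p)).2 ⟨p, hp, rfl⟩)
    exact hf h ▸ hq
  exact Face.ext fun p => ⟨key hσ hτ p, key hτ hσ p⟩

open Classical in
lemma IsListing.delete (hf : f.Injective) {l : List L} {j k : ℤ} (h : j + 1 = k) {τ : Face X k}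
    (hτ : IsListing f l τ) (v : τ.1) : IsListing f (l.erase (f v)) (τ.delete h v) := by
  refine ⟨hτ.1.erase _, fun y => ?_⟩
  rw [hτ.1.mem_erase_iff, hτ.2]
  constructor
  · rintro ⟨hy, p, hp, rfl⟩
    exact ⟨p, Finset.mem_erase.2 ⟨fun h => hy (h ▸ rfl), hp⟩, rfl⟩
  · rintro ⟨p, hp, rfl⟩
    obtain ⟨h1, h2⟩ := Finset.mem_erase.1 hp
    exact ⟨fun h => h1 (hf h), p, h2, rfl⟩

open Classical in
/-- The function on lists which takes the value `φ τ` on the listings of `τ`, and vanishes on the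
lists that are not listings of simplices. -/
noncomputable def extend (f : V → L) {k : ℤ} (φ : Cochain X k) (l : List L) : ZMod 2 :=
  if h : ∃ τ : Face X k, IsListing f l τ then φ h.choose else 0

lemma extend_of_isListing (hf : f.Injective) {k : ℤ} (φ : Cochain X k) {l : List L}
    {τ : Face X k} (h : IsListing f l τ) : extend f φ l = φ τ := by
  have h' : ∃ τ : Face X k, IsListing f l τ := ⟨τ, h⟩
  rw [extend, dif_pos h', h'.choose_spec.unique hf h]

lemma extend_of_not_nodup {k : ℤ} (φ : Cochain X k) {l : List L} (h : ¬ l.Nodup) :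
    extend f φ l = 0 :=
  dif_neg fun ⟨_, hτ⟩ => h hτ.1

open Classical in
lemma listCoboundary_eq_sum (F : List L → ZMod 2) {l : List L} (h : l.Nodup) :
    listCoboundary F l = ∑ y ∈ l.toFinset, F (l.erase y) := by
  induction l generalizing F with
  | nil => rfl
  | cons x l ih =>
    obtain ⟨hx, hl⟩ := List.nodup_cons.1 h
    rw [listCoboundary_cons, ih _ hl, List.toFinset_cons, Finset.sum_insert (by simpa using hx)]
    congr 1
    · simp
    · refine Finset.sum_congr rfl fun y hy => ?_
      rw [List.erase_cons_tail]
      simpa using fun h : x = y => hx (h ▸ List.mem_toFinset.1 hy)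

open Classical in
lemma IsListing.listCoboundary_eq (hf : f.Injective) (F : List L → ZMod 2) {l : List L}
    {k : ℤ} {τ : Face X k} (hτ : IsListing f l τ) :
    listCoboundary F l = ∑ v : τ.1, F (l.erase (f v)) := by
  rw [listCoboundary_eq_sum F hτ.1, Finset.sum_coe_sort τ.1 (fun v => F (l.erase (f v)))]
  symm
  refine Finset.sum_nbij f (fun p hp => ?_) hf.injOn (fun y hy => ?_) fun _ _ => rfl
  · exact List.mem_toFinset.2 ((hτ.2 _).2 ⟨p, hp, rfl⟩)
  · exact (hτ.2 y).1 (List.mem_toFinset.1 hy)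

lemma listCoboundary_extend (hf : f.Injective) {j k : ℤ} (h : j + 1 = k) (φ : Cochain X j)
    {l : List L} {τ : Face X k} (hτ : IsListing f l τ) :
    listCoboundary (extend f φ) l = coboundary h φ τ := by
  rw [hτ.listCoboundary_eq hf]
  exact Finset.sum_congr rfl fun v _ => extend_of_isListing hf φ (hτ.delete hf h v)

lemma isListing_toList {k : ℤ} (τ : Face X k) : IsListing id τ.1.toList τ :=
  ⟨τ.1.nodup_toList, by simp⟩

lemma coboundary_coboundary {i j k : ℤ} (hij : i + 1 = j) (hjk : j + 1 = k) (φ : Cochain X i) :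
    coboundary hjk (coboundary hij φ) = 0 := by
  classical
  funext τ
  rw [Pi.zero_apply, ← listCoboundary_listCoboundary (extend id φ) τ.1.toList,
    (isListing_toList τ).listCoboundary_eq Function.injective_id]
  exact Finset.sum_congr rfl fun v _ => (listCoboundary_extend Function.injective_id hij φ
    ((isListing_toList τ).delete Function.injective_id hjk v)).symm

lemma exists_eq_append_of_pairwise_of_not_nodup [PartialOrder L] {l : List L}
    (hl : l.Pairwise (· ≤ ·)) (h : ¬ l.Nodup) : ∃ u x w, l = u ++ x :: x :: w := by
  induction l with
  | nil => simp at h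
  | cons y l ih =>
    obtain ⟨hy, hl⟩ := List.pairwise_cons.1 hl
    by_cases hyl : y ∈ l
    · cases l with
      | nil => simp at hyl
      | cons z l =>
        refine ⟨[], y, l, ?_⟩
        have : z = y := by
          rcases List.mem_cons.1 hyl with rfl | h'
          · rfl
          · exact le_antisymm ((List.pairwise_cons.1 hl).1 y h') (hy z (by simp))
        simp [this]
    · obtain ⟨u, x, w, rfl⟩ := ih hl fun hn => h (List.nodup_cons.2 ⟨hyl, hn⟩)
      exact ⟨y :: u, x, w, rfl⟩

/-- Deleting either copy of `x` gives the same list, so these two terms cancel; every other deletion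
leaves a repetition. -/
lemma listCoboundary_append_cons_cons {F : List L → ZMod 2} (hF : ∀ l, ¬ l.Nodup → F l = 0)
    (u : List L) (x : L) (w : List L) : listCoboundary F (u ++ x :: x :: w) = 0 := by
  simp only [listCoboundary_append, listCoboundary_cons]
  have h1 : ∀ m, F (m ++ x :: x :: w) = 0 := fun m => hF _ (by simp [List.nodup_append])
  have h2 : ∀ m, F (u ++ x :: x :: m) = 0 := fun m => hF _ (by simp [List.nodup_append])
  simp only [h1, h2]
  simp [listCoboundary, CharTwo.add_self_eq_zero]

end Extend

/-! ### Listings in order complexes -/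

section OrderComplex

variable {L : Type*} [Lattice L] [BoundedOrder L]

lemma exists_isListing_pairwise {k : ℤ} (σ : Face (orderComplex (ProperPart L)) k) :
    ∃ l : List L, IsListing Subtype.val l σ ∧ l.Pairwise (· ≤ ·) := by
  classical
  have hchain : ∀ x ∈ σ.1, ∀ y ∈ σ.1, x ≤ y ∨ y ≤ x := by
    intro x hx y hy
    rcases σ.2.1 with h | h
    · simp [h] at hx
    · exact h.2.total hx hy
  generalize hs : σ.1 = s at hchain
  suffices h : ∃ l : List (ProperPart L), l.Nodup ∧ (∀ x, x ∈ l ↔ x ∈ s) ∧ l.Pairwise (· ≤ ·) by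
    obtain ⟨l, h1, h2, h3⟩ := h
    refine ⟨l.map Subtype.val, ⟨h1.map Subtype.val_injective, fun y => ?_⟩,
      h3.map _ fun _ _ h => h⟩
    simp only [List.mem_map, h2, hs]
  clear hs
  induction s using Finset.strongInduction with
  | H s ih =>
    rcases s.eq_empty_or_nonempty with rfl | hne
    · exact ⟨[], by simp⟩
    · obtain ⟨m, hm⟩ := s.exists_minimal hne
      obtain ⟨l, h1, h2, h3⟩ := ih (s.erase m) (Finset.erase_ssubset hm.1) fun x hx y hy =>
        hchain x (Finset.mem_of_mem_erase hx) y (Finset.mem_of_mem_erase hy)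
      refine ⟨m :: l, List.nodup_cons.2 ⟨by simp [h2], h1⟩, fun x => ?_,
        List.pairwise_cons.2 ⟨fun x hx => ?_, h3⟩⟩
      · rw [List.mem_cons, h2, Finset.mem_erase]
        by_cases hx : x = m
        · simp [hx, hm.1]
        · simp [hx]
      · have hx' := Finset.mem_of_mem_erase ((h2 x).1 hx)
        rcases hchain m hm.1 x hx' with h | h
        · exact h
        · exact hm.2 hx' h

/-- The vertices of a simplex of the order complex in increasing order. -/
noncomputable def chainList {k : ℤ} (σ : Face (orderComplex (ProperPart L)) k) : List L :=
  (exists_isListing_pairwise σ).choose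

lemma isListing_chainList {k : ℤ} (σ : Face (orderComplex (ProperPart L)) k) :
    IsListing Subtype.val (chainList σ) σ :=
  (exists_isListing_pairwise σ).choose_spec.1

lemma pairwise_chainList {k : ℤ} (σ : Face (orderComplex (ProperPart L)) k) :
    (chainList σ).Pairwise (· ≤ ·) :=
  (exists_isListing_pairwise σ).choose_spec.2

lemma chainList_eq {k : ℤ} {σ : Face (orderComplex (ProperPart L)) k} {l : List L}
    (h : IsListing Subtype.val l σ) (hl : l.Pairwise (· ≤ ·)) : chainList σ = l := by
  have hperm : (chainList σ).Perm l :=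
    (List.perm_ext_iff_of_nodup (isListing_chainList σ).1 h.1).2 fun y => by
      rw [(isListing_chainList σ).2, h.2]
  exact hperm.eq_of_pairwise (fun _ _ _ _ => le_antisymm) (pairwise_chainList σ) hl

open Classical in
lemma chainList_delete {j k : ℤ} (h : j + 1 = k) (σ : Face (orderComplex (ProperPart L)) k)
    (v : σ.1) : chainList (σ.delete h v) = (chainList σ).erase (v.1 : L) :=
  chainList_eq ((isListing_chainList σ).delete Subtype.val_injective h v)
    ((pairwise_chainList σ).sublist List.erase_sublist)

lemma coboundary_chainList {j k : ℤ} (h : j + 1 = k) (F : List L → ZMod 2)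
    (σ : Face (orderComplex (ProperPart L)) k) :
    coboundary h (fun τ => F (chainList τ)) σ = listCoboundary F (chainList σ) := by
  classical
  rw [(isListing_chainList σ).listCoboundary_eq Subtype.val_injective]
  exact Finset.sum_congr rfl fun v _ => congrArg F (chainList_delete h σ v)

lemma length_eq_of_isListing {k : ℤ} {σ : Face (orderComplex (ProperPart L)) k} {l : List L}
    (h : IsListing Subtype.val l σ) : (l.length : ℤ) = k + 1 := by
  classical
  have h1 : l.toFinset = σ.1.map (Function.Embedding.subtype _) := by
    ext y
    rw [List.mem_toFinset, h.2, Finset.mem_map]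
    rfl
  rw [← σ.2.2, ← List.toFinset_card_of_nodup h.1, h1, Finset.card_map]

lemma exists_isListing_of_pairwise {k : ℤ} {l : List L} (hn : l.Nodup)
    (hl : l.Pairwise (· ≤ ·)) (hk : (l.length : ℤ) = k + 1) (h0 : ∀ x ∈ l, x ≠ ⊥)
    (h1 : ∀ x ∈ l, x ≠ ⊤) :
    ∃ σ : Face (orderComplex (ProperPart L)) k, IsListing Subtype.val l σ := by
  classical
  have hs : ∀ y, y ∈ l ↔ ∃ p ∈ l.toFinset.subtype (fun x : L => x ≠ ⊥ ∧ x ≠ ⊤), p.1 = y := by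
    intro y
    simp only [Finset.mem_subtype, List.mem_toFinset, Subtype.exists]
    exact ⟨fun hy => ⟨y, ⟨h0 y hy, h1 y hy⟩, hy, rfl⟩, fun ⟨z, _, hz, hzy⟩ => hzy ▸ hz⟩
  refine ⟨⟨l.toFinset.subtype (fun x : L => x ≠ ⊥ ∧ x ≠ ⊤), ?_, ?_⟩, hn, hs⟩
  · rcases (l.toFinset.subtype (fun x : L => x ≠ ⊥ ∧ x ≠ ⊤)).eq_empty_or_nonempty with h | h
    · exact Or.inl h
    · refine Or.inr ⟨h, fun x hx y hy _ => ?_⟩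
      have hx' := (hs x).2 ⟨x, hx, rfl⟩
      have hy' := (hs y).2 ⟨y, hy, rfl⟩
      exact List.Pairwise.forall_of_forall_of_flip (R := fun a b : L => a ≤ b ∨ b ≤ a)
        (fun _ _ => Or.inl le_rfl) (hl.imp fun h => Or.inl h) (hl.imp fun h => Or.inr h) hx' hy'
  · rw [← hk, ← List.toFinset_card_of_nodup hn, Finset.card_subtype, Finset.filter_true_of_mem]
    exact fun x hx => ⟨h0 x (List.mem_toFinset.1 hx), h1 x (List.mem_toFinset.1 hx)⟩

/-- Terms of the contraction may contain repetitions. A weakly increasing list repeats only in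
adjacent positions, and then both sides vanish. -/
lemma listCoboundary_extend_of_pairwise {j k : ℤ} (h : j + 1 = k)
    (φ : Cochain (orderComplex (ProperPart L)) j) {l : List L}
    (hl : l.Pairwise (· ≤ ·)) (hk : (l.length : ℤ) = k + 1) (h0 : ∀ x ∈ l, x ≠ ⊥)
    (h1 : ∀ x ∈ l, x ≠ ⊤) :
    listCoboundary (extend Subtype.val φ) l = extend Subtype.val (coboundary h φ) l := by
  by_cases hn : l.Nodup
  · obtain ⟨σ, hσ⟩ := exists_isListing_of_pairwise hn hl hk h0 h1
    rw [listCoboundary_extend Subtype.val_injective h φ hσ,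
      extend_of_isListing Subtype.val_injective _ hσ]
  · obtain ⟨u, x, w, rfl⟩ := exists_eq_append_of_pairwise_of_not_nodup hl hn
    rw [extend_of_not_nodup _ hn]
    exact listCoboundary_append_cons_cons (fun l => extend_of_not_nodup φ) u x w

end OrderComplex

/-! ### Automorphisms of complexes and averaging -/

section Averaging

variable {V : Type*} {X : AbstractSimplicialComplex V}

variable (X) in
/-- The group of simplicial automorphisms of `X`. -/
def autGroup : Subgroup (Equiv.Perm V) where
  carrier := {g | ∀ s : Finset V, s.map g.toEmbedding ∈ X.faces ↔ s ∈ X.faces}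
  one_mem' s := by
    rw [show s.map (1 : Equiv.Perm V).toEmbedding = s from Finset.map_refl]
  mul_mem' {g h} hg hh s := by
    rw [← hh s, ← hg (s.map h.toEmbedding), Finset.map_map]
    rfl
  inv_mem' {g} hg s := by
    rw [← hg, Finset.map_map, show (g⁻¹).toEmbedding.trans g.toEmbedding = .refl V from
      Function.Embedding.ext fun v => g.apply_symm_apply v, Finset.map_refl]

instance (k : ℤ) : MulAction (autGroup X) (Face X k) where
  smul g σ := ⟨σ.1.map g.1.toEmbedding, by
    rw [Finset.map_eq_empty, g.2, Finset.card_map]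
    exact σ.2⟩
  one_smul σ := Subtype.ext Finset.map_refl
  mul_smul g h σ := Subtype.ext (Finset.map_map h.1.toEmbedding g.1.toEmbedding σ.1).symm

lemma coe_smul_face (g : autGroup X) {k : ℤ} (σ : Face X k) :
    (g • σ).1 = σ.1.map g.1.toEmbedding := rfl

lemma coboundary_comp_smul (g : autGroup X) {j k : ℤ} (h : j + 1 = k) (φ : Cochain X j)
    (τ : Face X k) : coboundary h (fun σ => φ (g • σ)) τ = coboundary h φ (g • τ) := by
  classical
  refine Fintype.sum_equiv (g.1.subtypeEquiv fun v => ?_) _ _ fun v => ?_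
  · rw [coe_smul_face, Finset.mem_map_equiv, Equiv.symm_apply_apply]
  · refine congrArg φ (Subtype.ext ?_)
    exact Finset.map_erase g.1.toEmbedding τ.1 v.1

open Classical in
lemma cochainNorm_eq {k : ℤ} [Fintype (Face X k)] (φ : Cochain X k) :
    cochainNorm φ = (Finset.univ.filter fun σ => φ σ ≠ 0).card := by
  unfold cochainNorm
  rw [Nat.card_eq_fintype_card, Fintype.card_subtype]

lemma cosystolicNorm_le {k : ℤ} (φ : Cochain X k) (ψ : Cochain X (k - 1)) :
    cosystolicNorm φ ≤ cochainNorm (φ + coboundary (sub_add_cancel k 1) ψ) :=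
  ciInf_le' _ ψ

/-- An infimum of natural numbers is attained; if its value were zero, `φ` would equal the
coboundary of the minimizer, signs being irrelevant modulo 2. -/
lemma cosystolicNorm_pos [Finite V] {k : ℤ} {φ : Cochain X k} (h : φ ∉ coboundaries X k) :
    0 < cosystolicNorm φ := by
  obtain ⟨ψ, hψ⟩ := ciInf_mem fun ψ : Cochain X (k - 1) =>
    cochainNorm (φ + coboundary (sub_add_cancel k 1) ψ)
  change cochainNorm _ = cosystolicNorm φ at hψ
  rw [← hψ]
  refine Nat.card_pos_iff.2 ?_
  refine ⟨?_, inferInstance⟩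
  by_contra hne
  refine h ⟨ψ, funext fun σ => ?_⟩
  by_contra hσ
  exact hne ⟨σ, fun h0 => hσ (CharTwo.add_eq_zero.1 h0).symm⟩

lemma cosystolicNorm_le_of_smul (g : autGroup X) {k : ℤ} (φ : Cochain X k)
    (ψ : Cochain X (k - 1)) :
    cosystolicNorm φ ≤
      cochainNorm ((fun σ => φ (g • σ)) + coboundary (sub_add_cancel k 1) ψ) := by
  refine (cosystolicNorm_le φ fun σ => ψ (g⁻¹ • σ)).trans_eq
    (Nat.card_congr ((MulAction.toPerm g⁻¹).subtypeEquiv fun σ => ?_))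
  simp [coboundary_comp_smul]

/-- If every cochain is cohomologous to one whose support is spread from the support of the
coboundary along a relation `R` with at most `N` related simplices for each `σ`, and the
automorphism group is transitive on `(k+1)`-simplices, then averaging bounds the cosystolic norm. -/
theorem faceCount_mul_cosystolicNorm_le [Finite V] {k : ℤ} {N : ℕ}
    (htrans : ∀ σ τ : Face X (k + 1), ∃ g : autGroup X, g • σ = τ)
    (R : Face X k → Face X (k + 1) → Prop) (hR : ∀ σ, Nat.card {τ // R σ τ} ≤ N)
    (hfill : ∀ φ : Cochain X k, ∃ ψ : Cochain X (k - 1), ∀ σ,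
      (φ + coboundary (sub_add_cancel k 1) ψ) σ ≠ 0 →
        ∃ τ, R σ τ ∧ coboundary (rfl : k + 1 = k + 1) φ τ ≠ 0)
    (φ : Cochain X k) :
    faceCount X (k + 1) * cosystolicNorm φ ≤
      cochainNorm (coboundary (rfl : k + 1 = k + 1) φ) * (faceCount X k * N) := by
  classical
  have := Fintype.ofFinite (Face X k)
  have := Fintype.ofFinite (Face X (k + 1))
  have := Fintype.ofFinite (autGroup X)
  set D := coboundary (rfl : k + 1 = k + 1) φ with hD
  let w : Face X (k + 1) → ℕ := fun τ => (Finset.univ.filter fun σ => R σ τ).card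
  have hw : ∑ τ, w τ ≤ faceCount X k * N := by
    have h1 : ∑ τ, w τ = ∑ σ, (Finset.univ.filter fun τ => R σ τ).card :=
      (Finset.sum_card_bipartiteAbove_eq_sum_card_bipartiteBelow (s := Finset.univ)
        (t := Finset.univ) R).symm
    rw [h1, faceCount, Nat.card_eq_fintype_card, ← smul_eq_mul]
    refine Finset.sum_le_card_nsmul _ _ _ fun σ _ => ?_
    have := hR σ
    rwa [Nat.card_eq_fintype_card, Fintype.card_subtype] at this
  -- Fill the translate of `φ` by `g⁻¹`, which has the same cosystolic norm; the support of its
  -- coboundary is the `g`-image of the support of `D`.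
  have hg : ∀ g : autGroup X, cosystolicNorm φ ≤
      ∑ τ ∈ Finset.univ.filter (fun τ => D τ ≠ 0), w (g • τ) := by
    intro g
    obtain ⟨ψ, hψ⟩ := hfill fun σ => φ (g⁻¹ • σ)
    refine (cosystolicNorm_le_of_smul g⁻¹ φ ψ).trans ?_
    rw [cochainNorm_eq]
    refine (Finset.card_le_card (t := (Finset.univ.filter fun τ => D τ ≠ 0).biUnion fun τ =>
      Finset.univ.filter fun σ => R σ (g • τ)) fun σ hσ => ?_).trans Finset.card_biUnion_le
    obtain ⟨τ, h1, h2⟩ := hψ σ (Finset.mem_filter.1 hσ).2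
    rw [coboundary_comp_smul] at h2
    refine Finset.mem_biUnion.2 ⟨g⁻¹ • τ, by simpa using h2, by simpa using h1⟩
  -- Right translation in the group moves `τ` to any other simplex, by transitivity.
  have hconst : ∀ τ τ', ∑ g : autGroup X, w (g • τ) = ∑ g : autGroup X, w (g • τ') := by
    intro τ τ'
    obtain ⟨h, rfl⟩ := htrans τ τ'
    refine (Fintype.sum_equiv (Equiv.mulRight h) _ _ fun g => ?_).symm
    simp [mul_smul]
  have hsum : ∀ τ, faceCount X (k + 1) * ∑ g : autGroup X, w (g • τ) =
      Fintype.card (autGroup X) * ∑ τ, w τ := by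
    intro τ
    calc faceCount X (k + 1) * ∑ g : autGroup X, w (g • τ)
        = ∑ τ' : Face X (k + 1), ∑ g : autGroup X, w (g • τ') := by
          rw [Finset.sum_congr rfl fun τ' _ => hconst τ' τ]
          simp [faceCount]
      _ = ∑ g : autGroup X, ∑ τ, w τ := by
          rw [Finset.sum_comm]
          exact Finset.sum_congr rfl fun g _ => Equiv.sum_comp (MulAction.toPerm g) w
      _ = _ := by simp
  have hG : 0 < Fintype.card (autGroup X) := Fintype.card_pos
  refine Nat.le_of_mul_le_mul_left ?_ hG
  calc Fintype.card (autGroup X) * (faceCount X (k + 1) * cosystolicNorm φ)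
      = faceCount X (k + 1) * ∑ g : autGroup X, cosystolicNorm φ := by
        simp; ring
    _ ≤ faceCount X (k + 1) *
        ∑ g : autGroup X, ∑ τ ∈ Finset.univ.filter (fun τ => D τ ≠ 0), w (g • τ) :=
        Nat.mul_le_mul_left _ (Finset.sum_le_sum fun g _ => hg g)
    _ = ∑ τ ∈ Finset.univ.filter (fun τ => D τ ≠ 0),
        Fintype.card (autGroup X) * ∑ τ, w τ := by
        rw [Finset.sum_comm, Finset.mul_sum]
        exact Finset.sum_congr rfl fun τ _ => hsum τ
    _ = Fintype.card (autGroup X) * (cochainNorm D * ∑ τ, w τ) := by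
        rw [Finset.sum_const, ← cochainNorm_eq, smul_eq_mul]
        ring
    _ ≤ _ := Nat.mul_le_mul_left _ (Nat.mul_le_mul_left _ hw)

/-- The indicator of one facet of `τ` has coboundary 1 at `τ`, so it is not a cocycle. This keeps
the infimum defining `cheeger` from being taken over the empty set. -/
lemma compl_coboundaries_nonempty {k : ℤ} (hk : -1 ≤ k) (τ : Face X (k + 1)) :
    (coboundaries X k)ᶜ.Nonempty := by
  classical
  have hne : τ.1.Nonempty := Finset.card_pos.1 (by have := τ.2.2; omega)
  obtain ⟨v, hv⟩ := hne
  let φ : Cochain X k := Pi.single (τ.delete rfl ⟨v, hv⟩) 1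
  refine ⟨φ, ?_⟩
  rintro ⟨ψ, hψ⟩
  have h0 : coboundary (rfl : k + 1 = k + 1) φ τ = 0 := by
    rw [← hψ, coboundary_coboundary]
    rfl
  rw [coboundary, Finset.sum_eq_single ⟨v, hv⟩] at h0
  · simp [φ] at h0
  · intro u _ hu
    refine Pi.single_eq_of_ne (fun he => hu ?_) _
    have he' := congrArg Subtype.val he
    by_contra hne
    have : u.1 ∈ (τ.delete rfl ⟨v, hv⟩ : Face X k).1 :=
      Finset.mem_erase.2 ⟨fun h => hne (Subtype.ext h), u.2⟩
    rw [← he'] at this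
    exact (Finset.mem_erase.1 this).1 rfl
  · simp

theorem le_cheeger [Finite V] {k : ℤ} (hk : -1 ≤ k) {N : ℕ} (hN : 0 < N)
    (h : ∀ φ : Cochain X k, faceCount X (k + 1) * cosystolicNorm φ ≤
      cochainNorm (coboundary (rfl : k + 1 = k + 1) φ) * (faceCount X k * N)) :
    (faceCount X (k + 1) : ℝ) / ((faceCount X k : ℝ) * N) ≤ cheeger X k := by
  have hpos : ∀ r ∈ expansion '' (coboundaries X k)ᶜ, 0 ≤ r := by
    rintro _ ⟨φ, -, rfl⟩
    unfold expansion
    positivity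
  -- Without `(k+1)`-simplices the bound is zero, and `sInf` of nonnegative reals is nonnegative
  -- even for the empty set.
  rcases isEmpty_or_nonempty (Face X (k + 1)) with h0 | ⟨⟨τ⟩⟩
  · rw [faceCount, Nat.card_of_isEmpty]
    simpa [cheeger] using Real.sInf_nonneg hpos
  · obtain ⟨v, hv⟩ : τ.1.Nonempty := Finset.card_pos.1 (by have := τ.2.2; omega)
    have hf : 0 < faceCount X k := Nat.card_pos_iff.2 ⟨⟨τ.delete rfl ⟨v, hv⟩⟩, inferInstance⟩
    refine le_csInf ((compl_coboundaries_nonempty hk τ).image _) ?_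
    rintro _ ⟨φ, hφ, rfl⟩
    have hc := cosystolicNorm_pos hφ
    rw [expansion, div_le_div_iff₀ (by positivity) (by positivity)]
    exact_mod_cast h φ

end Averaging

/-! ### Geometric lattices -/

section Geometric

variable {L : Type*} [Lattice L] [BoundedOrder L]

/-- An order automorphism of `L` as a permutation of the proper part. -/
def properPartPerm (g : L ≃o L) : Equiv.Perm (ProperPart L) :=
  g.toEquiv.subtypeEquiv fun x => by simp

lemma properPartPerm_mem_autGroup (g : L ≃o L) :
    properPartPerm g ∈ autGroup (orderComplex (ProperPart L)) := by
  intro s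
  change (_ ∧ _) ↔ (_ ∧ _)
  rw [Finset.map_nonempty, Finset.coe_map]
  refine and_congr_right fun _ => ?_
  rw [IsChain, IsChain, Set.InjOn.pairwise_image (Function.Embedding.injective _).injOn]
  have : ∀ x y : ProperPart L, properPartPerm g x ≤ properPartPerm g y ↔ x ≤ y :=
    fun x y => g.le_iff_le
  simp [Set.Pairwise, Function.onFun, this]

lemma IsHomogeneous.exists_smul_eq {n : ℕ} (h : IsHomogeneous L n)
    (σ τ : Face (orderComplex (ProperPart L)) ((n : ℤ) - 2)) :
    ∃ g : autGroup (orderComplex (ProperPart L)), g • σ = τ := by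
  obtain ⟨g, hg⟩ := h σ τ
  refine ⟨⟨properPartPerm g, properPartPerm_mem_autGroup g⟩, Face.ext fun p => ?_⟩
  have hp : p ∈ τ.1 ↔ p.1 ∈ (Subtype.val '' (τ.1 : Set (ProperPart L)) : Set L) :=
    (Subtype.val_injective.mem_set_image (s := (τ.1 : Set (ProperPart L)))).symm
  rw [hp, ← hg, coe_smul_face, Finset.mem_map]
  constructor
  · rintro ⟨q, hq, rfl⟩
    exact ⟨q.1, ⟨q, hq, rfl⟩, rfl⟩
  · rintro ⟨_, ⟨q, hq, rfl⟩, hqp⟩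
    exact ⟨q, hq, Subtype.ext hqp⟩

variable {rk : L → ℕ}

lemma IsGeometricLattice.rk_atom (hL : IsGeometricLattice L rk) {a : L} (ha : IsAtom a) :
    rk a = 1 := by
  rw [hL.rk_covBy ⊥ a (bot_covBy_iff.2 ha), hL.rk_bot]

/-- By semimodularity each further atom raises the rank by at most one. This keeps the contraction
away from `⊤`. -/
lemma IsGeometricLattice.rk_listSup_le (hL : IsGeometricLattice L rk) {w : List L}
    (hw : ∀ a ∈ w, IsAtom a) : rk (listSup w) ≤ w.length := by
  induction w with
  | nil => simp [hL.rk_bot]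
  | cons a w ih =>
    have h1 := ih fun b hb => hw b (by simp [hb])
    have h2 := hL.semimodular a (listSup w)
    rw [hL.rk_atom (hw a (by simp))] at h2
    simp only [listSup_cons, List.length_cons]
    omega

/-- In a geometric lattice of rank `n`, every cochain of degree `n - 3` is cohomologous to one that
is spread from its coboundary along the contraction. -/
theorem IsGeometricLattice.exists_filling [Finite L] {n : ℕ} (hn : 2 ≤ n)
    (hL : IsGeometricLattice L rk) (hrk : rk ⊤ = n) {k : ℤ} (hk : k = n - 3) :
    ∃ R : Face (orderComplex (ProperPart L)) k → Face (orderComplex (ProperPart L)) (k + 1) → Prop,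
      (∀ σ, Nat.card {τ // R σ τ} ≤ ∑ j ∈ Finset.Icc 1 (n - 1), j.factorial) ∧
      ∀ φ : Cochain (orderComplex (ProperPart L)) k,
        ∃ ψ : Cochain (orderComplex (ProperPart L)) (k - 1), ∀ σ,
          (φ + coboundary (sub_add_cancel k 1) ψ) σ ≠ 0 →
            ∃ τ, R σ τ ∧ coboundary (rfl : k + 1 = k + 1) φ τ ≠ 0 := by
  classical
  have hex : ∀ x : L, ∃ a, x ≠ ⊥ → IsAtom a ∧ a ≤ x := fun x => by
    by_cases hx : x = ⊥
    · exact ⟨x, fun h => absurd hx h⟩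
    · obtain ⟨a, ha⟩ := (IsAtomic.eq_bot_or_exists_atom_le x).resolve_left hx
      exact ⟨a, fun _ => ha⟩
  choose v hv using hex
  have htop : (⊤ : L) ≠ ⊥ := fun h => by
    have := hL.rk_bot
    rw [← h] at this
    omega
  have hlen : ∀ σ : Face (orderComplex (ProperPart L)) k, (chainList σ).length + 1 = n - 1 := by
    intro σ
    have := length_eq_of_isListing (isListing_chainList σ)
    omega
  have hproper : ∀ (σ : Face (orderComplex (ProperPart L)) k), ∀ x ∈ chainList σ,
      x ≠ ⊥ ∧ x ≠ ⊤ := by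
    intro σ x hx
    obtain ⟨p, -, rfl⟩ := ((isListing_chainList σ).2 x).1 hx
    exact p.2
  have hmem : ∀ (σ : Face (orderComplex (ProperPart L)) k),
      ∀ u ∈ contraction v (v ⊤) (chainList σ), (u.length : ℤ) = k + 1 + 1 ∧
        u.Pairwise (· ≤ ·) ∧ (∀ x ∈ u, x ≠ ⊥) ∧ ∀ x ∈ u, x ≠ ⊤ := by
    intro σ u hu
    obtain ⟨h1, h2, h3⟩ := mem_contraction v (hv ⊤ htop).1.1 (pairwise_chainList σ)
      (fun x hx => (hproper σ x hx).1) (fun x hx => (hv x (hproper σ x hx).1).2)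
      (fun x hx => (hv x (hproper σ x hx).1).1.1) hu
    have hl := hlen σ
    refine ⟨by omega, h2, fun x hx => (h3 x hx).1, fun x hx => ?_⟩
    rintro rfl
    rcases (h3 _ hx).2 with ⟨y, hy, hle⟩ | hle
    · exact (hproper σ y hy).2 (top_le_iff.1 hle)
    -- The list consists of `n - 1` atoms, one short of what a join equal to `⊤` requires.
    · have h4 := hL.rk_listSup_le (w := v ⊤ :: (chainList σ).map v) (by
        intro b hb
        rcases List.mem_cons.1 hb with rfl | hb
        · exact (hv ⊤ htop).1
        · obtain ⟨x, hx, rfl⟩ := List.mem_map.1 hb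
          exact (hv x (hproper σ x hx).1).1)
      rw [top_le_iff.1 hle, hrk] at h4
      simp only [List.length_cons, List.length_map] at h4
      omega
  refine ⟨fun σ τ => ∃ u ∈ contraction v (v ⊤) (chainList σ), IsListing Subtype.val u τ,
    fun σ => ?_, fun φ => ?_⟩
  · have h1 : (contraction v (v ⊤) (chainList σ)).length =
        ∑ j ∈ Finset.Icc 1 (n - 1), j.factorial := by rw [length_contraction, hlen]
    rw [← h1]
    refine le_trans ?_ (List.toFinset_card_le (contraction v (v ⊤) (chainList σ)))
    rw [← Nat.card_eq_finsetCard]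
    refine Nat.card_le_card_of_injective
      (fun τ => ⟨τ.2.choose, List.mem_toFinset.2 τ.2.choose_spec.1⟩) fun τ τ' h => ?_
    have h' : τ.2.choose = τ'.2.choose := congrArg Subtype.val h
    refine Subtype.ext (IsListing.unique Subtype.val_injective τ.2.choose_spec.2 ?_)
    rw [h']
    exact τ'.2.choose_spec.2
  · refine ⟨fun τ => listEval (extend Subtype.val φ) (contraction v (v ⊤) (chainList τ)),
      fun σ hσ => ?_⟩
    -- The homotopy identity: `φ + dψ` at `σ` is the sum of `dφ` over the terms of the contraction
    -- of `σ`.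
    have h1 : (φ + coboundary (sub_add_cancel k 1) fun τ =>
        listEval (extend Subtype.val φ) (contraction v (v ⊤) (chainList τ))) σ =
        listEval (extend Subtype.val (coboundary (rfl : k + 1 = k + 1) φ))
          (contraction v (v ⊤) (chainList σ)) := by
      rw [Pi.add_apply, coboundary_chainList (sub_add_cancel k 1)
        (fun m => listEval (extend Subtype.val φ) (contraction v (v ⊤) m)),
        ← extend_of_isListing Subtype.val_injective φ (isListing_chainList σ),
        ← listEval_listCoboundary_contraction]
      refine listEval_congr fun u hu => ?_
      obtain ⟨h1, h2, h3, h4⟩ := hmem σ u hu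
      exact listCoboundary_extend_of_pairwise rfl φ h2 h1 h3 h4
    rw [h1] at hσ
    by_contra! hcon
    refine hσ ((listEval_congr fun u hu => ?_).trans (listEval_zero _))
    by_cases hτ : ∃ τ : Face (orderComplex (ProperPart L)) (k + 1), IsListing Subtype.val u τ
    · obtain ⟨τ, hτ⟩ := hτ
      rw [extend_of_isListing Subtype.val_injective _ hτ]
      exact hcon τ ⟨u, hu, hτ⟩
    · exact dif_neg hτ

theorem IsGeometricLattice.le_cheeger [Finite L] {n : ℕ} (hn : 2 ≤ n)
    (hL : IsGeometricLattice L rk) (hrk : rk ⊤ = n) (hh : IsHomogeneous L n) :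
    (faceCount (orderComplex (ProperPart L)) ((n : ℤ) - 2) : ℝ) /
        ((faceCount (orderComplex (ProperPart L)) ((n : ℤ) - 3) : ℝ) *
          ∑ j ∈ Finset.Icc 1 (n - 1), (Nat.factorial j : ℝ))
      ≤ cheeger (orderComplex (ProperPart L)) ((n : ℤ) - 3) := by
  obtain ⟨k, hk⟩ : ∃ k : ℤ, k = n - 3 := ⟨_, rfl⟩
  have htrans := hh.exists_smul_eq
  rw [← hk]
  rw [show (n : ℤ) - 2 = k + 1 by omega] at htrans ⊢
  obtain ⟨R, hR, hfill⟩ := hL.exists_filling hn hrk hk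
  have hN : 0 < ∑ j ∈ Finset.Icc 1 (n - 1), j.factorial :=
    Finset.sum_pos (fun j _ => j.factorial_pos) ⟨1, Finset.mem_Icc.2 ⟨le_rfl, by omega⟩⟩
  have := CheegerLattice.le_cheeger (by omega) hN
    (faceCount_mul_cosystolicNorm_le htrans R hR hfill)
  push_cast at this
  exact this

end Geometric

/-! ### Ranks of the vertices of a simplex -/

section Ranked

variable {L : Type*} [Lattice L] [BoundedOrder L] {rk : L → ℕ} {n : ℕ} {k : ℤ}

lemma Face.le_or_le {P : Type*} [PartialOrder P] (σ : Face (orderComplex P) k) {p q : P}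
    (hp : p ∈ σ.1) (hq : q ∈ σ.1) : p ≤ q ∨ q ≤ p := by
  rcases σ.2.1 with h | h
  · simp [h] at hp
  · exact h.2.total hp hq

lemma Face.le_of_rk_le (hrk : StrictMono rk) (σ : Face (orderComplex (ProperPart L)) k)
    {p q : ProperPart L} (hp : p ∈ σ.1) (hq : q ∈ σ.1) (h : rk p.1 ≤ rk q.1) : p ≤ q := by
  rcases σ.le_or_le hp hq with h' | h'
  · exact h'
  · rcases h'.eq_or_lt with h'' | h''
    · exact h''.ge
    · exact absurd (hrk (show q.1 < p.1 from h'')) (by omega)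

lemma Face.injOn_rk (hrk : StrictMono rk) (σ : Face (orderComplex (ProperPart L)) k) :
    Set.InjOn (fun p : ProperPart L => rk p.1) σ.1 := fun _ hp _ hq h =>
  le_antisymm (σ.le_of_rk_le hrk hp hq (le_of_eq h)) (σ.le_of_rk_le hrk hq hp (ge_of_eq h))

lemma rk_mem_Icc (hrk : StrictMono rk) (hbot : rk ⊥ = 0) (htop : rk ⊤ = n) (p : ProperPart L) :
    rk p.1 ∈ Finset.Icc 1 (n - 1) := by
  have h1 := hrk (bot_lt_iff_ne_bot.2 p.2.1)
  have h2 := hrk (lt_top_iff_ne_top.2 p.2.2)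
  rw [Finset.mem_Icc]
  omega

lemma Face.image_rk_eq (hrk : StrictMono rk) (hbot : rk ⊥ = 0) (htop : rk ⊤ = n) (hn : 2 ≤ n)
    (σ : Face (orderComplex (ProperPart L)) ((n : ℤ) - 2)) :
    σ.1.image (fun p => rk p.1) = Finset.Icc 1 (n - 1) := by
  refine Finset.eq_of_subset_of_card_le
    (Finset.image_subset_iff.2 fun p _ => rk_mem_Icc hrk hbot htop p) ?_
  rw [Finset.card_image_of_injOn (σ.injOn_rk hrk), Nat.card_Icc]
  have := σ.2.2
  omega

/-- A simplex of dimension `n - 2` is a complete flag. -/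
lemma Face.exists_flag (hrk : StrictMono rk) (hbot : rk ⊥ = 0) (htop : rk ⊤ = n) (hn : 2 ≤ n)
    (σ : Face (orderComplex (ProperPart L)) ((n : ℤ) - 2)) :
    ∃ x : ℕ → L, (∀ i ≤ n, rk (x i) = i) ∧ (∀ i < n, x i ≤ x (i + 1)) ∧
      ∀ y, y ∈ Subtype.val '' (σ.1 : Set (ProperPart L)) ↔ ∃ i, 0 < i ∧ i < n ∧ x i = y := by
  have hex : ∀ i, ∃ y : L, (i = 0 → y = ⊥) ∧ (n ≤ i → y = ⊤) ∧
      (0 < i → i < n → ∃ p ∈ σ.1, p.1 = y ∧ rk p.1 = i) := by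
    intro i
    rcases Nat.eq_zero_or_pos i with rfl | hi
    · exact ⟨⊥, fun _ => rfl, fun h => by omega, fun h => by omega⟩
    rcases lt_or_ge i n with hin | hin
    · have hmem : i ∈ σ.1.image (fun p => rk p.1) := by
        rw [σ.image_rk_eq hrk hbot htop hn, Finset.mem_Icc]
        omega
      obtain ⟨p, hp, hpi⟩ := Finset.mem_image.1 hmem
      exact ⟨p.1, fun h => by omega, fun h => by omega, fun _ _ => ⟨p, hp, rfl, hpi⟩⟩
    · exact ⟨⊤, fun h => by omega, fun _ => rfl, fun _ h => by omega⟩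
  choose x hx0 hxn hx using hex
  refine ⟨x, fun i hi => ?_, fun i hi => ?_, fun y => ⟨?_, ?_⟩⟩
  · rcases Nat.eq_zero_or_pos i with rfl | hi0
    · rw [hx0 0 rfl, hbot]
    · rcases hi.lt_or_eq with hi | rfl
      · obtain ⟨p, -, hp, hpi⟩ := hx i hi0 hi
        rw [← hp, hpi]
      · rw [hxn _ le_rfl, htop]
  · rcases Nat.eq_zero_or_pos i with rfl | hi0
    · rw [hx0 0 rfl]
      exact bot_le
    rcases lt_or_ge (i + 1) n with hi1 | hi1
    · obtain ⟨p, hp, hpx, hpi⟩ := hx i hi0 hi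
      obtain ⟨q, hq, hqx, hqi⟩ := hx (i + 1) (by omega) hi1
      rw [← hpx, ← hqx]
      exact σ.le_of_rk_le hrk hp hq (by omega)
    · rw [hxn _ hi1]
      exact le_top
  · rintro ⟨p, hp, rfl⟩
    have hmem := rk_mem_Icc hrk hbot htop p
    rw [Finset.mem_Icc] at hmem
    obtain ⟨q, hq, hqx, hqi⟩ := hx (rk p.1) (by omega) (by omega)
    refine ⟨rk p.1, by omega, by omega, ?_⟩
    rw [← hqx, σ.injOn_rk hrk hq hp hqi]
  · rintro ⟨i, hi0, hi, rfl⟩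
    obtain ⟨p, hp, hpx, -⟩ := hx i hi0 hi
    exact ⟨p, hp, hpx⟩

/-- A simplex of dimension `n - 3` misses exactly one rank, and its extensions to complete flags
fill an interval of length two. -/
lemma Face.exists_gap (hrk : StrictMono rk) (hbot : rk ⊥ = 0) (htop : rk ⊤ = n) (hn : 2 ≤ n)
    (ρ : Face (orderComplex (ProperPart L)) ((n : ℤ) - 3)) :
    ∃ x y : L, x ≤ y ∧ rk y = rk x + 2 ∧
      ∀ z : ProperPart L, (x < z.1 ∧ z.1 < y) ↔ z ∉ ρ.1 ∧ ∀ p ∈ ρ.1, p ≤ z ∨ z ≤ p := by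
  have hsub : ρ.1.image (fun p => rk p.1) ⊆ Finset.Icc 1 (n - 1) :=
    Finset.image_subset_iff.2 fun p _ => rk_mem_Icc hrk hbot htop p
  -- The `n - 2` vertices have distinct ranks among `n - 1` possible ones.
  have hcard : (Finset.Icc 1 (n - 1) \ ρ.1.image (fun p => rk p.1)).card = 1 := by
    rw [Finset.card_sdiff_of_subset hsub, Finset.card_image_of_injOn (ρ.injOn_rk hrk),
      Nat.card_Icc]
    have := ρ.2.2
    omega
  obtain ⟨r, hr⟩ := Finset.card_eq_one.1 hcard
  have hmiss : ∀ i, (1 ≤ i ∧ i ≤ n - 1) ∧ (∀ p ∈ ρ.1, rk p.1 ≠ i) ↔ i = r := by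
    intro i
    rw [← Finset.mem_singleton, ← hr]
    simp
  obtain ⟨⟨hr1, hrn⟩, hrρ⟩ := (hmiss r).2 rfl
  have hex : ∀ i, 1 ≤ i → i ≤ n - 1 → i ≠ r → ∃ p ∈ ρ.1, rk p.1 = i := by
    intro i h1 h2 h3
    by_contra! h
    exact h3 ((hmiss i).1 ⟨⟨h1, h2⟩, h⟩)
  -- `x` is the vertex just below the missing rank `r`, or `⊥` when `r = 1`; dually, `y` below is
  -- the vertex just above it, or `⊤` when `r = n - 1`.
  obtain ⟨x, hxr, hxρ, hxc⟩ : ∃ x : L, rk x + 1 = r ∧ (∀ p ∈ ρ.1, rk p.1 < r → p.1 ≤ x) ∧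
      (x = ⊥ ∨ ∃ p ∈ ρ.1, p.1 = x) := by
    rcases hr1.eq_or_lt with h | h
    · refine ⟨⊥, by omega, fun p _ hp => ?_, Or.inl rfl⟩
      have := Finset.mem_Icc.1 (rk_mem_Icc hrk hbot htop p)
      omega
    · obtain ⟨p, hp, hpr⟩ := hex (r - 1) (by omega) (by omega) (by omega)
      exact ⟨p.1, by omega, fun q hq hqr => ρ.le_of_rk_le hrk hq hp (by omega),
        Or.inr ⟨p, hp, rfl⟩⟩
  obtain ⟨y, hyr, hyρ, hyc⟩ : ∃ y : L, rk y = r + 1 ∧ (∀ p ∈ ρ.1, r < rk p.1 → y ≤ p.1) ∧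
      (y = ⊤ ∨ ∃ p ∈ ρ.1, p.1 = y) := by
    rcases hrn.eq_or_lt with h | h
    · refine ⟨⊤, by omega, fun p _ hp => ?_, Or.inl rfl⟩
      have := Finset.mem_Icc.1 (rk_mem_Icc hrk hbot htop p)
      omega
    · obtain ⟨p, hp, hpr⟩ := hex (r + 1) (by omega) (by omega) (by omega)
      exact ⟨p.1, by omega, fun q hq hqr => ρ.le_of_rk_le hrk hp hq (by omega),
        Or.inr ⟨p, hp, rfl⟩⟩
  refine ⟨x, y, ?_, by omega, fun z => ⟨?_, ?_⟩⟩
  · rcases hxc with rfl | ⟨p, hp, rfl⟩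
    · exact bot_le
    rcases hyc with rfl | ⟨q, hq, rfl⟩
    · exact le_top
    exact ρ.le_of_rk_le hrk hp hq (by omega)
  · rintro ⟨h1, h2⟩
    have h1' := hrk h1
    have h2' := hrk h2
    refine ⟨fun hz => hrρ z hz (by omega), fun p hp => ?_⟩
    rcases lt_trichotomy (rk p.1) r with h | h | h
    · exact Or.inl ((hxρ p hp h).trans h1.le)
    · exact absurd h (hrρ p hp)
    · exact Or.inr (h2.le.trans (hyρ p hp h))
  · rintro ⟨hz, hc⟩
    have hlt : ∀ p ∈ ρ.1, p < z ∨ z < p := fun p hp => by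
      have hne : p ≠ z := fun h => hz (h ▸ hp)
      exact (hc p hp).imp (fun h => h.lt_of_ne hne) fun h => h.lt_of_ne hne.symm
    have hzr : rk z.1 = r := (hmiss _).1 ⟨Finset.mem_Icc.1 (rk_mem_Icc hrk hbot htop z),
      fun p hp h => (hlt p hp).elim (fun h' => (hrk (show p.1 < z.1 from h')).ne h)
        fun h' => (hrk (show z.1 < p.1 from h')).ne h.symm⟩
    constructor
    · rcases hxc with rfl | ⟨p, hp, rfl⟩
      · exact bot_lt_iff_ne_bot.2 z.2.1
      · refine (hlt p hp).resolve_right fun h => ?_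
        have := hrk (show z.1 < p.1 from h)
        omega
    · rcases hyc with rfl | ⟨p, hp, rfl⟩
      · exact lt_top_iff_ne_top.2 z.2.2
      · refine (hlt p hp).resolve_left fun h => ?_
        have := hrk (show p.1 < z.1 from h)
        omega

end Ranked

/-! ### Counting simplices -/

section Counting

variable {V : Type*} {X : AbstractSimplicialComplex V}

lemma card_facets {j k : ℤ} (h : j + 1 = k) (τ : Face X k) :
    Nat.card {ρ : Face X j // ρ.1 ⊆ τ.1} = τ.1.card := by
  classical
  rw [← Nat.card_eq_finsetCard]
  symm
  refine Nat.card_eq_of_bijective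
    (fun v : τ.1 => ⟨τ.delete h v, Finset.erase_subset _ _⟩) ⟨fun u v huv => ?_, fun ρ => ?_⟩
  · have : τ.1.erase u.1 = τ.1.erase v.1 := congrArg (fun ρ => ρ.1.1) huv
    exact Subtype.ext ((Finset.erase_inj _ u.2).1 this)
  · have h1 := ρ.1.2.2
    have h2 := τ.2.2
    obtain ⟨v, hv⟩ := Finset.card_eq_one.1 (show (τ.1 \ ρ.1.1).card = 1 by
      rw [Finset.card_sdiff_of_subset ρ.2]; omega)
    have hvτ : v ∈ τ.1 ∧ v ∉ ρ.1.1 := by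
      rw [← Finset.mem_sdiff, hv, Finset.mem_singleton]
    refine ⟨⟨v, hvτ.1⟩, Subtype.ext (Subtype.ext ?_)⟩
    change τ.1.erase v = ρ.1.1
    rw [Finset.erase_eq, ← hv, Finset.sdiff_sdiff_eq_self ρ.2]

lemma card_cofacets {P : Type*} [PartialOrder P] {j k : ℤ} (h : j + 1 = k)
    (ρ : Face (orderComplex P) j) :
    Nat.card {τ : Face (orderComplex P) k // ρ.1 ⊆ τ.1} =
      Nat.card {z : P // z ∉ ρ.1 ∧ ∀ p ∈ ρ.1, p ≤ z ∨ z ≤ p} := by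
  classical
  symm
  have hchain : ∀ z : P, (∀ p ∈ ρ.1, p ≤ z ∨ z ≤ p) →
      IsChain (· ≤ ·) ((insert z ρ.1 : Finset P) : Set P) := by
    intro z hz
    rw [Finset.coe_insert]
    refine IsChain.insert (fun p hp q hq _ => ρ.le_or_le hp hq) fun p hp _ => (hz p hp).symm
  refine Nat.card_eq_of_bijective (fun z => ⟨⟨insert z.1 ρ.1,
    Or.inr ⟨Finset.insert_nonempty _ _, hchain z.1 z.2.2⟩, ?_⟩, Finset.subset_insert _ _⟩)
    ⟨fun u v huv => ?_, fun τ => ?_⟩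
  · rw [Finset.card_insert_of_notMem z.2.1]
    have := ρ.2.2
    push_cast
    omega
  · have : insert u.1 ρ.1 = insert v.1 ρ.1 := congrArg (fun τ => τ.1.1) huv
    exact Subtype.ext ((Finset.insert_inj u.2.1).1 this)
  · have h1 := τ.1.2.2
    have h2 := ρ.2.2
    obtain ⟨v, hv⟩ := Finset.card_eq_one.1 (show (τ.1.1 \ ρ.1).card = 1 by
      rw [Finset.card_sdiff_of_subset τ.2]; omega)
    have hvτ : v ∈ τ.1.1 ∧ v ∉ ρ.1 := by
      rw [← Finset.mem_sdiff, hv, Finset.mem_singleton]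
    refine ⟨⟨v, hvτ.2, fun p hp => τ.1.le_or_le (τ.2 hp) hvτ.1⟩, Subtype.ext (Subtype.ext ?_)⟩
    change insert v ρ.1 = τ.1.1
    rw [Finset.insert_eq, ← hv, Finset.sdiff_union_of_subset τ.2]

/-- Double counting of incidences between simplices of dimensions `n - 2` and `n - 3`. -/
theorem faceCount_mul_eq {L : Type*} [Lattice L] [BoundedOrder L] [Finite L] {rk : L → ℕ} {n c : ℕ}
    (hrk : StrictMono rk) (hbot : rk ⊥ = 0) (htop : rk ⊤ = n) (hn : 2 ≤ n)
    (hc : ∀ x y : L, x ≤ y → rk y = rk x + 2 → Nat.card {z // x < z ∧ z < y} = c) :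
    faceCount (orderComplex (ProperPart L)) ((n : ℤ) - 2) * (n - 1) =
      faceCount (orderComplex (ProperPart L)) ((n : ℤ) - 3) * c := by
  classical
  have := Fintype.ofFinite (Face (orderComplex (ProperPart L)) ((n : ℤ) - 2))
  have := Fintype.ofFinite (Face (orderComplex (ProperPart L)) ((n : ℤ) - 3))
  have h := Finset.sum_card_bipartiteAbove_eq_sum_card_bipartiteBelow
    (s := (Finset.univ : Finset (Face (orderComplex (ProperPart L)) ((n : ℤ) - 2))))
    (t := (Finset.univ : Finset (Face (orderComplex (ProperPart L)) ((n : ℤ) - 3))))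
    (fun τ ρ => ρ.1 ⊆ τ.1)
  have hjk : (n : ℤ) - 3 + 1 = n - 2 := by ring
  have h1 : ∀ τ : Face (orderComplex (ProperPart L)) ((n : ℤ) - 2),
      (Finset.univ.filter fun ρ : Face (orderComplex (ProperPart L)) ((n : ℤ) - 3) =>
        ρ.1 ⊆ τ.1).card = n - 1 := by
    intro τ
    have h1 := card_facets hjk τ
    rw [Nat.card_eq_fintype_card, Fintype.card_subtype] at h1
    have h2 := τ.2.2
    omega
  have h2 : ∀ ρ : Face (orderComplex (ProperPart L)) ((n : ℤ) - 3),
      (Finset.univ.filter fun τ : Face (orderComplex (ProperPart L)) ((n : ℤ) - 2) =>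
        ρ.1 ⊆ τ.1).card = c := by
    intro ρ
    have h1 := card_cofacets hjk ρ
    rw [Nat.card_eq_fintype_card, Fintype.card_subtype] at h1
    obtain ⟨x, y, hxy, hr, hz⟩ := ρ.exists_gap hrk hbot htop hn
    rw [h1, ← hc x y hxy hr]
    refine Nat.card_congr ((Equiv.subtypeEquivRight fun z => (hz z).symm).trans
      (Equiv.subtypeSubtypeEquivSubtype
        (p := fun z : L => z ≠ ⊥ ∧ z ≠ ⊤) (q := fun z : L => x < z ∧ z < y) fun hz => ?_))
    exact ⟨(bot_le.trans_lt hz.1).ne', (hz.2.trans_le le_top).ne⟩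
  simp only [Finset.bipartiteAbove, Finset.bipartiteBelow, h1, h2] at h
  simpa [faceCount] using h

end Counting

/-! ### The lattice of subspaces -/

section Subspaces

open Module

variable {F W : Type*} [Field F] [AddCommGroup W] [Module F W]

lemma finrank_eq_of_covBy [FiniteDimensional F W] {x y : Submodule F W} (h : x ⋖ y) :
    finrank F y = finrank F x + 1 := by
  have h1 := isSimpleModule_iff_finrank_eq_one.1 ((covBy_iff_quot_is_simple h.le).1 h)
  have h2 := Submodule.finrank_quotient_add_finrank (x.submoduleOf y)
  have h3 := (Submodule.submoduleOfEquivOfLe h.le).finrank_eq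
  change finrank F (_ ⧸ x.submoduleOf y) = 1 at h1
  omega

lemma isGeometricLattice_submodule [Finite W] [FiniteDimensional F W] :
    IsGeometricLattice (Submodule F W) fun x => finrank F x where
  rk_bot := finrank_bot F W
  rk_covBy _ _ := finrank_eq_of_covBy
  semimodular x y := (Submodule.finrank_sup_add_finrank_inf_eq x y).le
  join_atoms x := by
    classical
    have hfin : {a : Submodule F W | IsAtom a ∧ a ≤ x}.Finite := Set.toFinite _
    refine ⟨hfin.toFinset, fun a ha => (hfin.mem_toFinset.1 ha).1, ?_⟩
    rw [Finset.sup_id_eq_sSup, hfin.coe_toFinset, sSup_atoms_le_eq]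

/-- Pick a vector in each step of the flag outside the previous one; adjoining it raises the
dimension by at least one and so fills the next step. -/
lemma exists_basis_flag [FiniteDimensional F W] {n : ℕ} (hW : finrank F W = n)
    {x : ℕ → Submodule F W} (hx : ∀ i ≤ n, finrank F (x i) = i)
    (hle : ∀ i < n, x i ≤ x (i + 1)) :
    ∃ b : Basis (Fin n) F W, ∀ i ≤ n, x i = Submodule.span F (b '' {j | (j : ℕ) < i}) := by
  have hex : ∀ i : Fin n, ∃ v ∈ x (i + 1), v ∉ x i := by
    intro i
    refine SetLike.exists_of_lt ((hle i i.2).lt_of_ne fun h => ?_)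
    have h1 := hx i i.2.le
    have h2 := hx (i + 1) i.2
    rw [h] at h1
    omega
  choose v hv hv' using hex
  have hspan : ∀ i ≤ n, x i = Submodule.span F (v '' {j | (j : ℕ) < i}) := by
    intro i
    induction i with
    | zero =>
      intro h
      simpa using Submodule.finrank_eq_zero.1 (hx 0 h)
    | succ i ih =>
      intro h
      have hset : {j : Fin n | (j : ℕ) < i + 1} = insert ⟨i, h⟩ {j : Fin n | (j : ℕ) < i} := by
        ext j
        simp only [Set.mem_ofPred_eq, Set.mem_insert_iff, Fin.ext_iff]
        omega
      rw [hset, Set.image_insert_eq, Submodule.span_insert, ← ih (by omega)]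
      have hvi : Submodule.span F {v ⟨i, h⟩} ≤ x (i + 1) := by
        rw [Submodule.span_singleton_le_iff_mem]
        exact hv ⟨i, h⟩
      symm
      refine Submodule.eq_of_le_of_finrank_le (sup_le hvi (hle i h)) ?_
      have hlt : x i < Submodule.span F {v ⟨i, h⟩} ⊔ x i := by
        refine lt_of_le_of_ne le_sup_right fun he => hv' ⟨i, h⟩ ?_
        change v ⟨i, h⟩ ∈ x i
        rw [he]
        exact (le_sup_left : _ ≤ Submodule.span F {v ⟨i, h⟩} ⊔ x i)
          (Submodule.mem_span_singleton_self _)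
      have := Submodule.finrank_lt_finrank_of_lt hlt
      rw [hx i (by omega)] at this
      rw [hx (i + 1) h]
      omega
  have htop : ⊤ ≤ Submodule.span F (Set.range v) := by
    have h1 := hspan n le_rfl
    rw [show {j : Fin n | (j : ℕ) < n} = Set.univ from Set.eq_univ_of_forall fun j => j.2,
      Set.image_univ] at h1
    rw [← h1]
    exact (Submodule.eq_top_of_finrank_eq ((hx n le_rfl).trans hW.symm)).ge
  refine ⟨basisOfTopLeSpanOfCardEqFinrank v htop (by simp [hW]), ?_⟩
  rw [coe_basisOfTopLeSpanOfCardEqFinrank]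
  exact hspan

/-- The linear automorphism matching bases adapted to the two flags carries one flag to the other.
-/
lemma isHomogeneous_submodule [FiniteDimensional F W] {n : ℕ} (hn : 2 ≤ n)
    (hW : finrank F W = n) : IsHomogeneous (Submodule F W) n := by
  intro σ τ
  have htop : finrank F (⊤ : Submodule F W) = n := by rw [finrank_top, hW]
  obtain ⟨x, hx1, hx2, hx3⟩ := σ.exists_flag Submodule.finrank_strictMono (finrank_bot F W) htop hn
  obtain ⟨y, hy1, hy2, hy3⟩ := τ.exists_flag Submodule.finrank_strictMono (finrank_bot F W) htop hn
  obtain ⟨b, hb⟩ := exists_basis_flag hW hx1 hx2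
  obtain ⟨b', hb'⟩ := exists_basis_flag hW hy1 hy2
  let e : W ≃ₗ[F] W := b.equiv b' (Equiv.refl _)
  have he : ∀ i ≤ n, Submodule.orderIsoMapComap e (x i) = y i := by
    intro i hi
    rw [hb i hi, hb' i hi, Submodule.orderIsoMapComap_apply, Submodule.map_span, ← Set.image_comp]
    congr 2
    funext j
    simp [e]
  refine ⟨Submodule.orderIsoMapComap e, Set.ext fun z => ?_⟩
  rw [hy3, Set.mem_image]
  constructor
  · rintro ⟨_, hw, rfl⟩
    obtain ⟨i, h0, hi, rfl⟩ := (hx3 _).1 hw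
    exact ⟨i, h0, hi, (he i hi.le).symm⟩
  · rintro ⟨i, h0, hi, rfl⟩
    exact ⟨x i, (hx3 _).2 ⟨i, h0, hi, rfl⟩, he i hi.le⟩

/-- These subspaces are the lines of a plane, that is, the points of a projective line. -/
lemma card_proper_of_finrank_two [Finite F] {U : Type*} [AddCommGroup U] [Module F U]
    (h : finrank F U = 2) :
    Nat.card {H : Submodule F U // ⊥ < H ∧ H < ⊤} = Nat.card F + 1 := by
  have : FiniteDimensional F U := FiniteDimensional.of_finrank_pos (by omega)
  rw [← Projectivization.card_of_finrank_two F U h]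
  refine Nat.card_congr ((Equiv.subtypeEquivRight fun H => ?_).trans
    (Projectivization.equivSubmodule F U).symm)
  constructor
  · rintro ⟨h1, h2⟩
    have h1 := Submodule.finrank_lt_finrank_of_lt h1
    have h2 := Submodule.finrank_lt_finrank_of_lt h2
    rw [finrank_bot] at h1
    rw [finrank_top] at h2
    omega
  · intro h1
    constructor
    · refine bot_lt_iff_ne_bot.2 ?_
      rintro rfl
      simp at h1
    · refine lt_top_iff_ne_top.2 ?_
      rintro rfl
      rw [finrank_top] at h1
      omega

/-- A relative complement `u` of `x` in `y` is a plane, and the diamond isomorphism for the modular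
lattice identifies the subspaces of `u` with the interval from `x` to `y`. -/
lemma card_between [Finite F] [FiniteDimensional F W] {x y : Submodule F W} (hxy : x ≤ y)
    (h : finrank F y = finrank F x + 2) :
    Nat.card {z // x < z ∧ z < y} = Nat.card F + 1 := by
  obtain ⟨c, hc⟩ := exists_isCompl x
  obtain ⟨u, hu⟩ : ∃ u, u = c ⊓ y := ⟨_, rfl⟩
  have hinf : u ⊓ x = ⊥ := by
    rw [hu, inf_right_comm, inf_comm c x, hc.inf_eq_bot, bot_inf_eq]
  have hsup : u ⊔ x = y := by
    rw [hu, sup_comm, ← sup_inf_assoc_of_le c hxy, hc.sup_eq_top, top_inf_eq]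
  have hfin : finrank F u = 2 := by
    have := Submodule.finrank_sup_add_finrank_inf_eq u x
    rw [hinf, hsup, finrank_bot] at this
    omega
  rw [← card_proper_of_finrank_two hfin]
  let e₁ : Submodule F u ≃o Set.Icc (u ⊓ x) u := u.mapIic.trans
    (OrderIso.setCongr _ _ (by rw [hinf, Set.Icc_bot]))
  let e : Submodule F u ≃o Set.Icc x (u ⊔ x) := e₁.trans (infIccOrderIsoIccSup u x)
  have hx : x ≤ u ⊔ x := le_sup_right
  have hbot : (e ⊥ : Submodule F W) = x := by
    have h1 : e ⊥ ≤ ⟨x, le_rfl, hx⟩ := by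
      rw [← e.le_symm_apply]
      exact bot_le
    exact le_antisymm h1 (e ⊥).2.1
  have htop : (e ⊤ : Submodule F W) = u ⊔ x := by
    have h1 : ⟨u ⊔ x, hx, le_rfl⟩ ≤ e ⊤ := by
      rw [← e.symm_apply_le]
      exact le_top
    exact le_antisymm (e ⊤).2.2 h1
  rw [← hsup]
  symm
  refine Nat.card_congr ((e.toEquiv.subtypeEquiv (q := fun z => x < z.1 ∧ z.1 < u ⊔ x)
    fun H => ?_).trans (Equiv.subtypeSubtypeEquivSubtype
      (p := fun z => z ∈ Set.Icc x (u ⊔ x)) (q := fun z => x < z ∧ z < u ⊔ x)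
      fun hz => ⟨hz.1.le, hz.2.le⟩))
  have h1 : x < (e H).1 ↔ ⊥ < H := by rw [← e.lt_iff_lt, ← Subtype.coe_lt_coe, hbot]
  have h2 : (e H).1 < u ⊔ x ↔ H < ⊤ := by rw [← e.lt_iff_lt, ← Subtype.coe_lt_coe, htop]
  exact (and_congr h1 h2).symm

/-- The standard flag in dimensions `1, ..., n - 2`. This makes the denominator in the closed form
nonzero. -/
lemma nonempty_face_building (F : Type*) [Field F] {n : ℕ} (hn : 2 ≤ n) :
    Nonempty (Face (building F n) ((n : ℤ) - 3)) := by
  classical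
  let b := Pi.basisFun F (Fin n)
  have hmono := b.flag_strictMono
  let f : Fin (n - 2) → ProperPart (Submodule F (Fin n → F)) := fun i =>
    ⟨b.flag ⟨i + 1, by omega⟩, by
      rw [← bot_lt_iff_ne_bot, ← lt_top_iff_ne_top, ← b.flag_zero, ← b.flag_last,
        hmono.lt_iff_lt, hmono.lt_iff_lt, Fin.lt_def, Fin.lt_def]
      simp only [Fin.val_zero, Fin.val_last]
      omega⟩
  have hf : StrictMono f := fun i j hij => hmono (Fin.mk_lt_mk.2 (Nat.succ_lt_succ hij))
  refine ⟨⟨Finset.univ.image f, ?_, ?_⟩⟩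
  · rcases (Finset.univ.image f).eq_empty_or_nonempty with h | h
    · exact Or.inl h
    · refine Or.inr ⟨h, ?_⟩
      rw [Finset.coe_image, Finset.coe_univ, Set.image_univ]
      exact hf.monotone.isChain_range
  · rw [Finset.card_image_of_injective _ hf.injective, Finset.card_univ, Fintype.card_fin]
    omega

end Subspaces

end CheegerLattice

open CheegerLattice in
theorem theoremt :
    (∀ (L : Type*) [Lattice L] [BoundedOrder L] [Finite L] (rk : L → ℕ) (n : ℕ),
      2 ≤ n → IsGeometricLattice L rk → rk ⊤ = n → IsHomogeneous L n →
      (faceCount (orderComplex (ProperPart L)) ((n : ℤ) - 2) : ℝ) /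
          ((faceCount (orderComplex (ProperPart L)) ((n : ℤ) - 3) : ℝ) *
            ∑ j ∈ Finset.Icc 1 (n - 1), (Nat.factorial j : ℝ))
        ≤ cheeger (orderComplex (ProperPart L)) ((n : ℤ) - 3)) ∧
    (∀ (F : Type*) [Field F] [Finite F] (n : ℕ), 2 ≤ n →
      (faceCount (building F n) ((n : ℤ) - 2) : ℝ) /
          ((faceCount (building F n) ((n : ℤ) - 3) : ℝ) *
            ∑ j ∈ Finset.Icc 1 (n - 1), (Nat.factorial j : ℝ))
        ≤ cheeger (building F n) ((n : ℤ) - 3) ∧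
      (faceCount (building F n) ((n : ℤ) - 2) : ℝ) /
          ((faceCount (building F n) ((n : ℤ) - 3) : ℝ) *
            ∑ j ∈ Finset.Icc 1 (n - 1), (Nat.factorial j : ℝ))
        = ((Nat.card F : ℝ) + 1) /
          (((n : ℝ) - 1) * ∑ j ∈ Finset.Icc 1 (n - 1), (Nat.factorial j : ℝ))) := by
  refine ⟨fun L _ _ _ rk n hn hL hrk hh => hL.le_cheeger hn hrk hh, fun F _ _ n hn => ?_⟩
  have hdim : Module.finrank F (Fin n → F) = n := by simp
  have htop : Module.finrank F (⊤ : Submodule F (Fin n → F)) = n := by rw [finrank_top, hdim]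
  refine ⟨isGeometricLattice_submodule.le_cheeger hn htop (isHomogeneous_submodule hn hdim), ?_⟩
  have hcount := faceCount_mul_eq (L := Submodule F (Fin n → F)) Submodule.finrank_strictMono
    (finrank_bot F _) htop hn fun x y hxy h => card_between hxy h
  have hpos : 0 < faceCount (building F n) ((n : ℤ) - 3) :=
    Nat.card_pos_iff.2 ⟨nonempty_face_building F hn, inferInstance⟩
  have hsum : 0 < ∑ j ∈ Finset.Icc 1 (n - 1), (Nat.factorial j : ℝ) :=
    Finset.sum_pos (fun j _ => by positivity) ⟨1, Finset.mem_Icc.2 ⟨le_rfl, by omega⟩⟩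
  have hn1 : 0 < (n : ℝ) - 1 := by
    have : (2 : ℝ) ≤ n := by exact_mod_cast hn
    linarith
  have hcount' : (faceCount (building F n) ((n : ℤ) - 2) : ℝ) * ((n : ℝ) - 1) =
      faceCount (building F n) ((n : ℤ) - 3) * ((Nat.card F : ℝ) + 1) := by
    have h := congrArg (Nat.cast : ℕ → ℝ) hcount
    push_cast [Nat.cast_sub (show 1 ≤ n by omega)] at h
    exact h
  rw [div_eq_div_iff (by positivity) (by positivity)]
  linear_combination (∑ j ∈ Finset.Icc 1 (n - 1), (Nat.factorial j : ℝ)) * hcount'
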